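/- For an integer $n\ge 7$ let $S=\{\pm a,\pm b,\pm c\}\subset\mathbb{Z}_n=\mathbb{Z}/n\mathbb{Z}$ with $|S|=6$ and $\langle S\rangle=\mathbb{Z}_n$. Let $\mathrm{Circ}(n;S)$ be the graph on $\mathbb{Z}_n$ in which $x,y$ are adjacent iff $y-x\in S$. A graph $(V,E)$ of order $N$ is distance magic if there are a bijection $\ell\colon V\to\{1,\dots,N\}$ and a positive integer $\kappa$ with $\sum_{u\sim v}\ell(u)=\kappa$ for every $v\in V$. An integer $0\le j<n$ is called admissible if $\sum_{s\in S}e^{2\pi \mathbf{i}js/n}=0$, that is, if $\cos(2\pi ja/n)+\cos(2\pi jb/n)+\cos(2\pi jc/n)=0$. For an admissible $j$ let $0\le r_1\le r_2\le r_3\le 1$ be the rational numbers, in increasing order, for which $\cos(r_1\pi),\cos(r_2\pi),\cos(r_3\pi)$ are the three cosines $\cos(2\pi ja/n),\cos(2\pi jb/n),\cos(2\pi jc/n)$. The admissible $j$ is * of type 1 if $0\le r_1\le\frac12$, $r_2=\frac12$, $r_3=1-r_1$; * of type 2 if $0\le r_1\le\frac13$, $r_2=\frac23-r_1$, $r_3=\frac23+r_1$;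 * of type 3 if $(r_1,r_2,r_3)$ is $(\frac15,\frac35,\frac23)$ or $(\frac13,\frac25,\frac45)$. **Proposition.** Suppose that $\mathrm{Circ}(n;S)$ is distance magic and that there is at least one admissible $j$ of type 3. Then, identifying the elements of $\mathbb{Z}_n$ with $0,1,\dots,n-1$, all of the following hold: 1. $60\mid n$, the largest power of $3$ dividing $n$ is $3$, and the largest power of $5$ dividing $n$ is $5$; 2. there is a unique $s\in S$ with $5\mid s$ and $s<n/2$, and this $s$ is $n/12$ or $5n/12$; 3. there is at least one admissible $j$ of type 1, and there is no admissible $j$ of type 2; 4. every admissible $j$ of type 1 is odd and divisible by $15$, and every admissible $j$ of type 3 is even and coprime to $15$. -/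

import Mathlib

/-- A finite graph is distance magic if its vertices can be labelled bijectively by
`1, 2, …, |V|` so that all the neighbourhood sums are equal to one positive integer `κ`. -/
def IsDistanceMagic {V : Type*} [Fintype V] (G : SimpleGraph V) [DecidableRel G.Adj] : Prop :=
  ∃ ℓ : V → ℕ, Set.BijOn ℓ Set.univ (Set.Icc 1 (Fintype.card V)) ∧
    ∃ κ : ℕ, 0 < κ ∧ ∀ v : V, ∑ u ∈ G.neighborFinset v, ℓ u = κ

/-- The irreducible character `χ_j` of `ℤ/nℤ`, `χ_j(x) = (exp (2πi/n))^(j x)`. -/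
noncomputable def circChar (n j : ℕ) (x : ZMod n) : ℂ :=
  Complex.exp (2 * Real.pi * Complex.I / n) ^ (j * x.val)

/-- The set of admissible elements: those `j ∈ {0, …, n - 1}` with
`χ_j(S) = ∑ s ∈ S, χ_j(s) = 0`. -/
def admissibleSet (n : ℕ) (S : Finset (ZMod n)) : Set ℕ :=
  {j | j < n ∧ ∑ s ∈ S, circChar n j s = 0}

/-- The representative in `[0, 1]` of the rational number `2 j s / n`, taken modulo `2` and up to
sign; equivalently the unique `r ∈ [0, 1]` with `cos (r π) = cos (2 π j s / n)`.
Here `ZMod.valMinAbs` is the representative in `(-n/2, n/2]` of a residue class. -/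
def reducedAngle (n j : ℕ) (s : ZMod n) : ℚ :=
  2 * |(((j : ZMod n) * s).valMinAbs : ℚ)| / n

/-- For `S = {±a, ±b, ±c}` with `|S| = 6`: the triple `r₁ ≤ r₂ ≤ r₃` consists of the reduced
angles of `a`, `b`, `c` with respect to `j`, listed in increasing order. -/
def IsAngleTriple (n : ℕ) (S : Finset (ZMod n)) (j : ℕ) (r₁ r₂ r₃ : ℚ) : Prop :=
  r₁ ≤ r₂ ∧ r₂ ≤ r₃ ∧
    ∃ s₁ s₂ s₃ : ZMod n, S = {s₁, -s₁, s₂, -s₂, s₃, -s₃} ∧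
      reducedAngle n j s₁ = r₁ ∧ reducedAngle n j s₂ = r₂ ∧ reducedAngle n j s₃ = r₃

/-- The admissible `j` of type 1. -/
def IsAdmissibleType1 (n : ℕ) (S : Finset (ZMod n)) (j : ℕ) : Prop :=
  j ∈ admissibleSet n S ∧ ∃ r₁ r₂ r₃ : ℚ, IsAngleTriple n S j r₁ r₂ r₃ ∧
    0 ≤ r₁ ∧ r₁ ≤ 1 / 2 ∧ r₂ = 1 / 2 ∧ r₃ = 1 - r₁

/-- The admissible `j` of type 2. -/
def IsAdmissibleType2 (n : ℕ) (S : Finset (ZMod n)) (j : ℕ) : Prop :=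
  j ∈ admissibleSet n S ∧ ∃ r₁ r₂ r₃ : ℚ, IsAngleTriple n S j r₁ r₂ r₃ ∧
    0 ≤ r₁ ∧ r₁ ≤ 1 / 3 ∧ r₂ = 2 / 3 - r₁ ∧ r₃ = 2 / 3 + r₁

/-- The admissible `j` of type 3. -/
def IsAdmissibleType3 (n : ℕ) (S : Finset (ZMod n)) (j : ℕ) : Prop :=
  j ∈ admissibleSet n S ∧ ∃ r₁ r₂ r₃ : ℚ, IsAngleTriple n S j r₁ r₂ r₃ ∧
    ((r₁ = 1 / 5 ∧ r₂ = 3 / 5 ∧ r₃ = 2 / 3) ∨ (r₁ = 1 / 3 ∧ r₂ = 2 / 5 ∧ r₃ = 4 / 5))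

/-! Write `n = p * q` and sort the terms of a vanishing sum of `n`-th roots of unity by their `q`-th
powers. Galois conjugation makes every class sum vanish if `p ∣ q`, and makes the normalized class
sums equal if `p ∤ q`. An admissible `j` gives such a sum with six terms, in three inverse pairs.

The magic labelling enters through two facts. Its Fourier transform is supported on `0` and the
admissible elements, so injectivity forbids a nonzero common annihilator of these. For even `n`,
some admissible `j` is divisible by `3`: otherwise all sums over cosets of the subgroup of order
three would be `3 * (n + 1) / 2`, which is not an integer.

One `j` of type 3 gives `30 ∣ n` and fixes enough of `a, b, c` modulo `2, 3, 5`
(`IsExceptionalTriple`) to control every other admissible `j`. If `9 ∣ n` or `25 ∣ n`, a term alone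
in its class forces `3 ∣ j` or `5 ∣ j` for all of them, so there is a common annihilator. Hence the
classes modulo `3` and `5` leave only two kinds (`admissible_dichotomy`): either `n ∣ 30 * j` and
`j` is coprime to `15`, or `15 ∣ j`. In the second case the terms have order coprime to `15` and
cancel in antipodal pairs, so one cosine vanishes; by parity it is that of `c`, and `j` is of type
1.

The admissible multiple of `3` is of the second kind, whence `4 ∣ n`. Both kinds annihilate `60 *
c`, so `n ∣ 60 * c`. Since `5 ∣ c`, the order of `c` divides `12`, and it is exactly `12`. -/

open Finset

/-! ### Vanishing sums of roots of unity -/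

/-- Galois conjugation: a vanishing sum of `m`-th roots of unity stays zero when every term is
raised to a power coprime to `m`. -/
theorem sum_pow_eq_zero_of_coprime {ι : Type*} {s : Finset ι} {z : ι → ℂ} {m k : ℕ} (hm : m ≠ 0)
    (hz : ∀ i ∈ s, z i ^ m = 1) (hsum : ∑ i ∈ s, z i = 0) (hk : k.Coprime m) :
    ∑ i ∈ s, z i ^ k = 0 := by
  have : NeZero m := ⟨hm⟩
  have hζ := Complex.isPrimitiveRoot_exp m hm
  set ζ := Complex.exp (2 * Real.pi * Complex.I / m)
  have hex : ∀ i, ∃ e : ℕ, i ∈ s → ζ ^ e = z i := fun i => by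
    by_cases hi : i ∈ s
    · obtain ⟨e, -, he⟩ := hζ.eq_pow_of_pow_eq_one (hz i hi)
      exact ⟨e, fun _ => he⟩
    · exact ⟨0, fun h => absurd h hi⟩
  choose e he using hex
  let P : Polynomial ℤ := ∑ i ∈ s, Polynomial.X ^ e i
  have h0 : Polynomial.aeval ζ P = 0 := by
    simp only [P, map_sum, map_pow, Polynomial.aeval_X]
    rw [← hsum]
    exact sum_congr rfl he
  have hdvd : minpoly ℤ ζ ∣ P :=
    minpoly.isIntegrallyClosed_dvd (hζ.isIntegral (Nat.pos_of_ne_zero hm)) h0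
  have h1 : Polynomial.aeval (ζ ^ k) P = 0 := by
    obtain ⟨Q, hQ⟩ := hdvd
    rw [hQ, map_mul, hζ.minpoly_eq_pow_coprime hk, minpoly.aeval, zero_mul]
  simp only [P, map_sum, map_pow, Polynomial.aeval_X] at h1
  rw [← h1]
  refine sum_congr rfl fun i hi => ?_
  rw [← he i hi, ← pow_mul, ← pow_mul, mul_comm]

theorem sum_range_pow_of_pow_eq_one {p : ℕ} {u : ℂ} (hu : u ^ p = 1) :
    ∑ t ∈ range p, u ^ t = if u = 1 then (p : ℂ) else 0 := by
  split_ifs with h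
  · simp [h]
  · rw [geom_sum_eq h, hu, sub_self, zero_div]

/-- Fourier inversion for the classes of `m`-th roots of unity modulo the `q`-th ones,
`m = p * q`. -/
theorem mul_sum_class {ι : Type*} {s : Finset ι} {z : ι → ℂ} {p q : ℕ}
    (hz : ∀ i ∈ s, z i ^ (p * q) = 1) {w : ℂ} (hw : w ^ p = 1) (hw0 : w ≠ 0) :
    (p : ℂ) * ∑ i ∈ s, (if z i ^ q = w then z i else 0) =
      ∑ t ∈ range p, w⁻¹ ^ t * ∑ i ∈ s, z i ^ (1 + q * t) := by
  simp_rw [mul_sum]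
  rw [sum_comm]
  refine sum_congr rfl fun i hi => ?_
  have hu : (z i ^ q / w) ^ p = 1 := by
    rw [div_pow, ← pow_mul, mul_comm q, hz i hi, hw, div_one]
  have h := sum_range_pow_of_pow_eq_one hu
  have h2 : ∑ t ∈ range p, w⁻¹ ^ t * z i ^ (1 + q * t) =
      z i * ∑ t ∈ range p, (z i ^ q / w) ^ t := by
    rw [mul_sum]
    refine sum_congr rfl fun t _ => ?_
    rw [pow_add, pow_mul, div_eq_mul_inv, mul_pow]; ring
  rw [h2, h]
  simp only [div_eq_one_iff_eq hw0]
  split_ifs <;> simp [mul_comm]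

theorem coprime_one_add_mul {p q t : ℕ} (hp : p.Prime) (h : ¬ p ∣ 1 + q * t) :
    (1 + q * t).Coprime (p * q) := by
  refine Nat.Coprime.mul_right ?_ ?_
  · exact ((Nat.Prime.coprime_iff_not_dvd hp).2 h).symm
  · simp

theorem ne_zero_of_pow_eq_one {w : ℂ} {p : ℕ} (hp : p ≠ 0) (hw : w ^ p = 1) : w ≠ 0 := by
  rintro rfl
  simp [hp] at hw

/-- In a vanishing sum of `p * q`-th roots of unity with `p ∣ q`, the terms of each class sum to
zero. -/
theorem sum_class_eq_zero {ι : Type*} {s : Finset ι} {z : ι → ℂ} {p q : ℕ} (hp : p.Prime)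
    (hq : q ≠ 0) (hz : ∀ i ∈ s, z i ^ (p * q) = 1) (hsum : ∑ i ∈ s, z i = 0) (hpq : p ∣ q)
    {w : ℂ} (hw : w ^ p = 1) : ∑ i ∈ s, (if z i ^ q = w then z i else 0) = 0 := by
  have h := mul_sum_class hz hw (ne_zero_of_pow_eq_one hp.ne_zero hw)
  rw [sum_eq_zero (s := range p)] at h
  · exact (mul_eq_zero.1 h).resolve_left (Nat.cast_ne_zero.2 hp.ne_zero)
  · intro t _
    rw [sum_pow_eq_zero_of_coprime (mul_ne_zero hp.ne_zero hq) hz hsum, mul_zero]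
    refine coprime_one_add_mul hp fun hd => hp.one_lt.ne' ?_
    exact Nat.dvd_one.1 ((Nat.dvd_add_left (hpq.mul_right t)).1 hd)

/-- In a vanishing sum of `p * q`-th roots of unity with `p ∤ q`, the normalized class sums are all
equal. -/
theorem exists_sum_class_eq {ι : Type*} {s : Finset ι} {z : ι → ℂ} {p q : ℕ} (hp : p.Prime)
    (hq : q ≠ 0) (hz : ∀ i ∈ s, z i ^ (p * q) = 1) (hsum : ∑ i ∈ s, z i = 0) (hpq : ¬ p ∣ q) :
    ∃ (v : ℕ) (K : ℂ), ∀ w : ℂ, w ^ p = 1 →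
      (∑ i ∈ s, (if z i ^ q = w then z i else 0)) * w ^ v = K := by
  have : Fact p.Prime := ⟨hp⟩
  have hq0 : (q : ZMod p) ≠ 0 := by rwa [Ne, ZMod.natCast_eq_zero_iff]
  have key : ∀ t : ℕ, p ∣ 1 + q * t ↔ (t : ZMod p) = -(q : ZMod p)⁻¹ := fun t => by
    rw [← ZMod.natCast_eq_zero_iff]
    push_cast
    constructor
    · intro h
      field_simp
      linear_combination h
    · intro h
      rw [h]
      field_simp
      ring
  -- Among `t < p` this is the only one with `p ∣ 1 + q * t`; all other terms of the inversion
  -- formula vanish by conjugation.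
  set v := (-(q : ZMod p)⁻¹).val with hv
  have hvp : v < p := ZMod.val_lt _
  refine ⟨v, (∑ i ∈ s, z i ^ (1 + q * v)) / p, fun w hw => ?_⟩
  have hw0 := ne_zero_of_pow_eq_one hp.ne_zero hw
  have h := mul_sum_class hz hw hw0
  rw [sum_eq_single_of_mem v (mem_range.2 hvp)] at h
  · have hp0 : (p : ℂ) ≠ 0 := Nat.cast_ne_zero.2 hp.ne_zero
    rw [eq_div_iff hp0, mul_right_comm, mul_comm _ (p : ℂ), h, inv_pow]
    field_simp
  · intro t ht htv
    rw [sum_pow_eq_zero_of_coprime (mul_ne_zero hp.ne_zero hq) hz hsum, mul_zero]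
    refine coprime_one_add_mul hp fun hd => htv ?_
    rw [hv, ← (key t).1 hd, ZMod.val_natCast, Nat.mod_eq_of_lt (mem_range.1 ht)]

/-- A vanishing sum of at most six `m`-th roots of unity, `m` even and coprime to `15`, is
antipodal: every odd function sums to zero over it. -/
theorem sum_odd_eq_zero {ι : Type*} {m : ℕ} (hm0 : m ≠ 0) (h2 : 2 ∣ m) (h3 : ¬ 3 ∣ m)
    (h5 : ¬ 5 ∣ m) {s : Finset ι} {z : ι → ℂ} (hs : s.card ≤ 6) (hz : ∀ i ∈ s, z i ^ m = 1)
    (hsum : ∑ i ∈ s, z i = 0) {f : ℂ → ℂ} (hf : ∀ u, f (-u) = -f u) :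
    ∑ i ∈ s, f (z i) = 0 := by
  classical
  induction m using Nat.strong_induction_on generalizing s z f with
  | _ m ih =>
  obtain ⟨m', rfl⟩ := h2
  by_cases h1 : m' = 1
  · subst h1
    have : ∀ i ∈ s, f (z i) = z i * f 1 := fun i hi => by
      rcases _root_.mul_self_eq_one_iff.1 (by simpa [sq] using hz i hi : z i * z i = 1) with h | h
      · rw [h, one_mul]
      · rw [h, hf, neg_one_mul]
    rw [sum_congr rfl this, ← sum_mul, hsum, zero_mul]
  obtain ⟨p, hp, r, rfl⟩ := Nat.exists_prime_and_dvd h1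
  have hr : r ≠ 0 := by rintro rfl; simp at hm0
  -- The prime `p` is split off while the factor `2` stays in `q`, so the induction ends at `m = 2`.
  set q := 2 * r with hqdef
  have hmq : 2 * (p * r) = p * q := by rw [hqdef]; ring
  rw [hmq] at ih hm0 h3 h5 hz
  have hq0 : q ≠ 0 := by omega
  have hclass : ∀ w : ℂ, w ^ p = 1 → ∑ i ∈ s, (if z i ^ q = w then z i else 0) = 0 := by
    intro w hw
    by_cases hpq : p ∣ q
    · exact sum_class_eq_zero hp hq0 hz hsum hpq hw
    · obtain ⟨v, K, hK⟩ := exists_sum_class_eq hp hq0 hz hsum hpq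
      -- With at least seven classes and at most six terms, some class is empty, so the common
      -- normalized sum is zero.
      have hp7 : 7 ≤ p := by
        by_contra hlt
        have := hp.two_le
        have hp' := hp
        interval_cases p
        · exact hpq ⟨r, rfl⟩
        · exact h3 (Dvd.intro _ rfl)
        · exact absurd hp' (by norm_num)
        · exact h5 (Dvd.intro _ rfl)
        · exact absurd hp' (by norm_num)
      have hprim := Complex.isPrimitiveRoot_exp p hp.ne_zero
      obtain ⟨w0, hw0, hw0'⟩ : ∃ w0 ∈ Polynomial.nthRootsFinset p (1 : ℂ),
          w0 ∉ s.image (fun i => z i ^ q) := by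
        refine exists_mem_notMem_of_card_lt_card ?_
        rw [hprim.card_nthRootsFinset]
        exact lt_of_le_of_lt card_image_le (by omega)
      rw [Polynomial.mem_nthRootsFinset hp.pos] at hw0
      have hK0 := hK w0 hw0
      rw [sum_eq_zero, zero_mul] at hK0
      · have := hK w hw
        rw [← hK0] at this
        exact (mul_eq_zero.1 this).resolve_right
          (pow_ne_zero _ (ne_zero_of_pow_eq_one hp.ne_zero hw))
      · intro i hi
        rw [if_neg]
        intro h
        exact hw0' (mem_image.2 ⟨i, hi, h⟩)
  rw [← sum_fiberwise_of_maps_to (t := s.image (fun i => z i ^ q)) (g := fun i => z i ^ q)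
    (fun i hi => mem_image_of_mem _ hi)]
  refine sum_eq_zero fun w hw => ?_
  obtain ⟨i₀, hi₀, rfl⟩ := mem_image.1 hw
  have hg0 : z i₀ ≠ 0 := ne_zero_of_pow_eq_one hm0 (hz i₀ hi₀)
  have hc := hclass (z i₀ ^ q) (by rw [← pow_mul, mul_comm q, hz i₀ hi₀])
  rw [← sum_filter] at hc
  -- Dividing a class by one of its members turns it into `q`-th roots of unity, and `u ↦ f (z i₀ *
  -- u)` is again odd.
  have := ih q (by nlinarith [hp.two_le, Nat.pos_of_ne_zero hq0]) hq0 ⟨r, rfl⟩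
    (fun h => h3 (h.mul_left p)) (fun h => h5 (h.mul_left p))
    (s := s.filter (fun i => z i ^ q = z i₀ ^ q)) (z := fun i => z i / z i₀)
    (f := fun u => f (z i₀ * u)) ((card_filter_le _ _).trans hs)
    (fun i hi => by
      rw [div_pow, (mem_filter.1 hi).2, div_self (pow_ne_zero _ hg0)])
    (by rw [← sum_div, hc, zero_div])
    (fun u => by rw [mul_neg, hf])
  rw [← this]
  refine sum_congr rfl fun i _ => ?_
  rw [mul_div_cancel₀ _ hg0]

/-! ### Three inverse pairs of roots of unity -/

theorem sum_inv_fin_six (x y z : ℂ) :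
    ∑ i, (![x, x⁻¹, y, y⁻¹, z, z⁻¹] : Fin 6 → ℂ) i = x + x⁻¹ + (y + y⁻¹) + (z + z⁻¹) := by
  rw [Fin.sum_univ_six]
  simp
  ring

theorem forall_inv_pow_eq_one {x y z : ℂ} {n : ℕ} (hx : x ^ n = 1) (hy : y ^ n = 1)
    (hz : z ^ n = 1) : ∀ i ∈ (univ : Finset (Fin 6)),
      (![x, x⁻¹, y, y⁻¹, z, z⁻¹] : Fin 6 → ℂ) i ^ n = 1 := by
  intro i _
  fin_cases i <;> simp [hx, hy, hz]

theorem inv_ne_self_of_pow_eq_one {w : ℂ} {p : ℕ} (hp : Odd p) (hw : w ^ p = 1) (hw1 : w ≠ 1) :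
    w⁻¹ ≠ w := by
  intro h
  have h0 := ne_zero_of_pow_eq_one hp.pos.ne' hw
  obtain ⟨k, rfl⟩ := hp
  have h2 : w ^ 2 = 1 := by
    rw [sq]; nth_rewrite 1 [← h]; exact inv_mul_cancel₀ h0
  rw [pow_add, pow_mul, h2, one_pow, one_mul, pow_one] at hw
  exact hw1 hw

section

variable {x y z : ℂ}

/-- The class of `z` contains no other term, so its vanishing sum would be `z` itself. -/
theorem false_of_three_dvd {q : ℕ} (hq : q ≠ 0) (h3 : 3 ∣ q) (hx : x ^ q = 1) (hy : y ^ q = 1)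
    (hz : z ^ (3 * q) = 1) (hz1 : z ^ q ≠ 1)
    (hsum : x + x⁻¹ + (y + y⁻¹) + (z + z⁻¹) = 0) : False := by
  have hw : (z ^ q) ^ 3 = 1 := by rw [← pow_mul, mul_comm, hz]
  have hinv := inv_ne_self_of_pow_eq_one (by decide) hw hz1
  have h := sum_class_eq_zero Nat.prime_three hq
    (forall_inv_pow_eq_one (n := 3 * q) (by rw [mul_comm, pow_mul, hx, one_pow])
      (by rw [mul_comm, pow_mul, hy, one_pow]) hz) ((sum_inv_fin_six x y z).trans hsum) h3 hw
  rw [Fin.sum_univ_six] at h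
  simp [hx, hy, hz1.symm, hinv] at h
  simp [h, hq] at hz

/-- The two nontrivial classes are `z` alone and `z⁻¹` alone. Their normalizations are mutually
inverse and both equal `K`, so `K ^ 2 = 1`; the trivial class sums to `K` as well. -/
theorem exists_of_not_three_dvd {q : ℕ} (hq : q ≠ 0) (h3 : ¬ 3 ∣ q) (hx : x ^ q = 1)
    (hy : y ^ q = 1) (hz : z ^ (3 * q) = 1) (hz1 : z ^ q ≠ 1)
    (hsum : x + x⁻¹ + (y + y⁻¹) + (z + z⁻¹) = 0) :
    x + x⁻¹ + (y + y⁻¹) = 1 ∨ x + x⁻¹ + (y + y⁻¹) = -1 := by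
  have hw : (z ^ q) ^ 3 = 1 := by rw [← pow_mul, mul_comm, hz]
  have hz0 := ne_zero_of_pow_eq_one (mul_ne_zero three_ne_zero hq) hz
  have hinv := inv_ne_self_of_pow_eq_one (by decide) hw hz1
  obtain ⟨v, K, hK⟩ := exists_sum_class_eq Nat.prime_three hq
    (forall_inv_pow_eq_one (n := 3 * q) (by rw [mul_comm, pow_mul, hx, one_pow])
      (by rw [mul_comm, pow_mul, hy, one_pow]) hz) ((sum_inv_fin_six x y z).trans hsum) h3
  have h1 := hK 1 (one_pow _)
  have h2 := hK _ hw
  have h3 := hK (z ^ q)⁻¹ (by rw [inv_pow, hw, inv_one])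
  rw [Fin.sum_univ_six] at h1 h2 h3
  simp [hx, hy, hz1, hz1.symm, hinv, hinv.symm] at h1 h2 h3
  rw [← mul_self_eq_one_iff]
  have hK2 : K * K = 1 := by
    nth_rewrite 1 [← h2]
    rw [← h3]
    field_simp
  rw [← hK2, ← h1]
  ring

theorem false_of_five_dvd {q : ℕ} (hq : q ≠ 0) (h5 : 5 ∣ q) (hz : z ^ q = 1)
    (hx : x ^ (5 * q) = 1) (hy : y ^ (5 * q) = 1) (hx1 : x ^ q ≠ 1) (hxy : y ^ q ≠ x ^ q)
    (hxy' : (y ^ q)⁻¹ ≠ x ^ q) (hsum : x + x⁻¹ + (y + y⁻¹) + (z + z⁻¹) = 0) : False := by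
  have hw : (x ^ q) ^ 5 = 1 := by rw [← pow_mul, mul_comm, hx]
  have hinv := inv_ne_self_of_pow_eq_one (by decide) hw hx1
  have h := sum_class_eq_zero Nat.prime_five hq
    (forall_inv_pow_eq_one (n := 5 * q) hx hy (by rw [mul_comm, pow_mul, hz, one_pow]))
    ((sum_inv_fin_six x y z).trans hsum) h5 hw
  rw [Fin.sum_univ_six] at h
  simp [hz, hx1.symm, hinv, hxy, hxy'] at h
  simp [h, hq] at hx

/-- The terms `x, x⁻¹, y, y⁻¹` are alone in their classes, and `z, z⁻¹` form the trivial one.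
Comparing `x` with `x⁻¹` gives `K ^ 2 = 1`. Thus `x` is, up to sign, a fifth root of unity, and `z +
z⁻¹ = K`. -/
theorem pow_ten_eq_one_of_not_five_dvd {q : ℕ} (hq : q ≠ 0) (h5 : ¬ 5 ∣ q) (hz : z ^ q = 1)
    (hx : x ^ (5 * q) = 1) (hy : y ^ (5 * q) = 1) (hx1 : x ^ q ≠ 1) (hxy : y ^ q ≠ x ^ q)
    (hxy' : (y ^ q)⁻¹ ≠ x ^ q) (hy1 : y ^ q ≠ 1)
    (hsum : x + x⁻¹ + (y + y⁻¹) + (z + z⁻¹) = 0) :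
    x ^ 10 = 1 ∧ (z + z⁻¹) ^ 2 = 1 := by
  have hw : (x ^ q) ^ 5 = 1 := by rw [← pow_mul, mul_comm, hx]
  have hx0 := ne_zero_of_pow_eq_one (mul_ne_zero (by norm_num) hq) hx
  have hinv := inv_ne_self_of_pow_eq_one (by decide) hw hx1
  obtain ⟨v, K, hK⟩ := exists_sum_class_eq Nat.prime_five hq
    (forall_inv_pow_eq_one (n := 5 * q) hx hy (by rw [mul_comm, pow_mul, hz, one_pow]))
    ((sum_inv_fin_six x y z).trans hsum) h5
  have h2 := hK _ hw
  have h3 := hK (x ^ q)⁻¹ (by rw [inv_pow, hw, inv_one])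
  have e1 : y ^ q ≠ (x ^ q)⁻¹ := fun h => hxy' (by rw [h, inv_inv])
  rw [Fin.sum_univ_six] at h2 h3
  simp [hz, hx1, hx1.symm, hinv, hinv.symm, hxy, hxy', e1] at h2 h3
  have hK2 : K * K = 1 := by
    nth_rewrite 1 [← h2]
    rw [← h3]
    field_simp
  constructor
  · have h4 : x ^ 2 * ((x ^ q) ^ v) ^ 2 = 1 := by
      rw [← hK2, ← h2]; ring
    have h6 : (x ^ 2 * ((x ^ q) ^ v) ^ 2) ^ 5 = x ^ 10 * ((x ^ q) ^ 5) ^ (2 * v) := by ring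
    rw [h4, hw, one_pow, one_pow, mul_one] at h6
    exact h6.symm
  · have h1 := hK 1 (one_pow _)
    rw [Fin.sum_univ_six] at h1
    simp [hz, hx1, hy1] at h1
    rw [h1, sq, hK2]

theorem pow_six_eq_one_of_add_inv_sq (hz0 : z ≠ 0) (h : (z + z⁻¹) ^ 2 = 1) : z ^ 6 = 1 := by
  field_simp at h
  linear_combination (z ^ 2 - 1) * h

/-- The sign is that of a half-plane. Summed over an antipodal family it turns the cancellation into
a parity count. -/
theorem exists_odd_sign : ∃ f : ℂ → ℂ, (∀ u, f (-u) = -f u) ∧ ∀ u, u ≠ 0 → f u = 1 ∨ f u = -1 := by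
  classical
  refine ⟨fun u => if 0 < u.re ∨ (u.re = 0 ∧ 0 < u.im) then 1
    else if u = 0 then 0 else -1, fun u => ?_, fun u hu => ?_⟩
  · by_cases h0 : u = 0
    · simp [h0]
    · have : ¬ (u.re = 0 ∧ u.im = 0) := fun h => h0 (Complex.ext h.1 h.2)
      simp only [Complex.neg_re, Complex.neg_im, neg_eq_zero, h0, if_false]
      by_cases h : 0 < u.re ∨ (u.re = 0 ∧ 0 < u.im)
      · rw [if_pos h, if_neg]
        rintro (h' | ⟨h', h''⟩) <;> rcases h with h | ⟨h, h'''⟩ <;> linarith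
      · rw [if_neg h, if_pos, neg_neg]
        push Not at h
        rcases h.1.lt_or_eq with h1 | h1
        · left; linarith
        · right
          exact ⟨h1, by linarith [(h.2 h1).lt_of_ne fun h2 => this ⟨h1, h2⟩]⟩
  · dsimp only
    split_ifs <;> simp_all

/-- Moving `±1` to the left gives five roots of unity with sum zero. By antipodality five signs
would sum to zero, which is impossible for an odd number of them. -/
theorem false_of_add_inv_eq_one {m : ℕ} (hm0 : m ≠ 0) (h2 : 2 ∣ m) (h3 : ¬ 3 ∣ m)
    (h5 : ¬ 5 ∣ m) (hx : x ^ m = 1) (hy : y ^ m = 1)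
    (h : x + x⁻¹ + (y + y⁻¹) = 1 ∨ x + x⁻¹ + (y + y⁻¹) = -1) : False := by
  obtain ⟨K, hK, hxy⟩ : ∃ K : ℂ, K ^ 2 = 1 ∧ x + x⁻¹ + (y + y⁻¹) = -K := by
    rcases h with h | h
    · exact ⟨-1, by norm_num, by rw [h]; norm_num⟩
    · exact ⟨1, by norm_num, h⟩
  obtain ⟨f, hf, hf1⟩ := exists_odd_sign
  have hKm : K ^ m = 1 := by
    obtain ⟨r, rfl⟩ := h2
    rw [pow_mul, hK, one_pow]
  have hx0 := ne_zero_of_pow_eq_one hm0 hx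
  have hy0 := ne_zero_of_pow_eq_one hm0 hy
  have hK0 := ne_zero_of_pow_eq_one hm0 hKm
  have := sum_odd_eq_zero (s := (univ : Finset (Fin 5))) (z := ![x, x⁻¹, y, y⁻¹, K]) hm0 h2 h3 h5
    (by simp) (by intro i _; fin_cases i <;> simp [hx, hy, hKm])
    (by rw [Fin.sum_univ_five]; simp; linear_combination hxy) hf
  rw [Fin.sum_univ_five] at this
  simp at this
  rcases hf1 x hx0 with h1 | h1 <;> rcases hf1 _ (inv_ne_zero hx0) with h2 | h2 <;>
    rcases hf1 y hy0 with h3 | h3 <;> rcases hf1 _ (inv_ne_zero hy0) with h4 | h4 <;>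
    rcases hf1 K hK0 with h5 | h5 <;> rw [h1, h2, h3, h4, h5] at this <;> norm_num at this

/-- One of the three cosines vanishes. -/
theorem exists_add_inv_eq_zero {m : ℕ} (hm0 : m ≠ 0) (h2 : 2 ∣ m) (h3 : ¬ 3 ∣ m)
    (h5 : ¬ 5 ∣ m) (hx : x ^ m = 1) (hy : y ^ m = 1) (hz : z ^ m = 1)
    (hsum : x + x⁻¹ + (y + y⁻¹) + (z + z⁻¹) = 0) :
    x + x⁻¹ = 0 ∨ y + y⁻¹ = 0 ∨ z + z⁻¹ = 0 := by
  have hx0 := ne_zero_of_pow_eq_one hm0 hx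
  have hy0 := ne_zero_of_pow_eq_one hm0 hy
  have hz0 := ne_zero_of_pow_eq_one hm0 hz
  -- The odd function `u ^ 3` shows that the doubled cosines `a, b, c`, besides `a + b + c = 0`,
  -- satisfy `a ^ 3 + b ^ 3 + c ^ 3 = 0`, that is `3 * a * b * c = 0`.
  have h := sum_odd_eq_zero hm0 h2 h3 h5 (by simp) (forall_inv_pow_eq_one hx hy hz)
    ((sum_inv_fin_six x y z).trans hsum) (f := fun u => u ^ 3) (fun u => by ring)
  rw [Fin.sum_univ_six] at h
  simp at h
  have hcube : ∀ u : ℂ, u ≠ 0 → u ^ 3 + (u ^ 3)⁻¹ = (u + u⁻¹) ^ 3 - 3 * (u + u⁻¹) := by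
    intro u hu
    field_simp
    ring
  have h' : (x + x⁻¹) ^ 3 + (y + y⁻¹) ^ 3 + (z + z⁻¹) ^ 3 = 0 := by
    linear_combination h - hcube x hx0 - hcube y hy0 - hcube z hz0 + 3 * hsum
  have : 3 * ((x + x⁻¹) * ((y + y⁻¹) * (z + z⁻¹))) = 0 := by
    generalize x + x⁻¹ = a at *
    generalize y + y⁻¹ = b at *
    generalize z + z⁻¹ = c at *
    have : c = -(a + b) := by linear_combination hsum
    subst this
    linear_combination h'
  simpa [mul_eq_zero] using this

theorem eq_neg_or_mul_eq_neg_one (hx0 : x ≠ 0) (hy0 : y ≠ 0) (h : x + x⁻¹ + (y + y⁻¹) = 0) :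
    x = -y ∨ x * y = -1 := by
  have : (x + y) * (x * y + 1) = 0 := by
    field_simp at h
    linear_combination h
  rcases mul_eq_zero.1 this with h | h
  · exact Or.inl (eq_neg_of_add_eq_zero_left h)
  · exact Or.inr (eq_neg_of_add_eq_zero_left h)

end

/-! ### Fourier analysis of a magic labelling -/

section

variable {n : ℕ} [NeZero n]

theorem circChar_eq_stdAddChar (j : ℕ) (s : ZMod n) :
    circChar n j s = ZMod.stdAddChar ((j : ZMod n) * s) := by
  have h := ZMod.stdAddChar_coe (N := n) ((j * s.val : ℕ) : ℤ)
  push_cast at h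
  rw [ZMod.natCast_zmod_val] at h
  rw [h, circChar, ← Complex.exp_nat_mul]
  congr 1
  push_cast
  ring

theorem mem_admissibleSet_iff {S : Finset (ZMod n)} {j : ℕ} :
    j ∈ admissibleSet n S ↔
      j < n ∧ ∑ s ∈ S, (ZMod.stdAddChar ((j : ZMod n) * s) : ℂ) = 0 := by
  simp only [admissibleSet, Set.mem_ofPred_eq, circChar_eq_stdAddChar]

theorem dft_comp_add_right (f : ZMod n → ℂ) (t k : ZMod n) :
    ZMod.dft (fun v => f (v + t)) k = ZMod.stdAddChar (k * t) * ZMod.dft f k := by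
  rw [ZMod.dft_apply, ZMod.dft_apply, mul_sum]
  refine Fintype.sum_equiv (Equiv.addRight t) _ _ fun v => ?_
  simp only [Equiv.coe_addRight, smul_eq_mul]
  rw [← mul_assoc, ← AddChar.map_add_eq_mul]
  congr 2
  ring

/-- A function whose nonzero Fourier coefficients vanish is constant. -/
theorem natCast_mul_eq_sum_of_dft_eq_zero {f : ZMod n → ℂ} (hf : ∀ k ≠ 0, ZMod.dft f k = 0)
    (x : ZMod n) : (n : ℂ) * f x = ∑ v, f v := by
  have h : ZMod.dft.symm (ZMod.dft f) x = f x := by rw [LinearEquiv.symm_apply_apply]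
  rw [ZMod.invDFT_apply, sum_eq_single 0 (fun k _ hk => by rw [hf k hk, smul_zero])
    (fun h => absurd (mem_univ _) h), ZMod.dft_apply_zero, zero_mul,
    AddChar.map_zero_eq_one, one_smul, smul_eq_mul] at h
  rw [← h, mul_inv_cancel_left₀ (Nat.cast_ne_zero.2 (NeZero.ne n))]

/-- The support of the Fourier transform of a function with constant sums over the translates of
`S` consists of `0` and admissible elements. -/
theorem dft_eq_zero_of_not_admissible {S : Finset (ZMod n)} {f : ZMod n → ℂ} {κ : ℂ}
    (hf : ∀ v, ∑ s ∈ S, f (v + s) = κ) {k : ZMod n} (hk : k ≠ 0)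
    (hadm : k.val ∉ admissibleSet n S) : ZMod.dft f k = 0 := by
  have h1 : ZMod.dft (fun v => ∑ s ∈ S, f (v + s)) k =
      (∑ s ∈ S, (ZMod.stdAddChar (k * s) : ℂ)) * ZMod.dft f k := by
    rw [sum_mul, ← sum_congr rfl fun s _ => dft_comp_add_right f s k]
    simp only [ZMod.dft_apply, smul_sum]
    exact sum_comm
  have h2 : ZMod.dft (fun v => ∑ s ∈ S, f (v + s)) k = 0 := by
    have h := AddChar.sum_eq_zero_of_ne_one (ZMod.isPrimitive_stdAddChar n (neg_ne_zero.2 hk))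
    simp only [hf, ZMod.dft_apply, ← sum_smul]
    simp only [AddChar.mulShift_apply] at h
    simp only [← mul_neg, mul_comm _ (-k), h, zero_smul]
  rw [h2] at h1
  refine (mul_eq_zero.1 h1.symm).resolve_left fun h => hadm ?_
  exact mem_admissibleSet_iff.2 ⟨ZMod.val_lt k, by rwa [ZMod.natCast_zmod_val]⟩

/-- If all admissible elements annihilate `t`, then `t` is a period. -/
theorem eq_zero_of_forall_admissible_mul_eq_zero {S : Finset (ZMod n)} {f : ZMod n → ℂ} {κ : ℂ}
    (hinj : Function.Injective f) (hf : ∀ v, ∑ s ∈ S, f (v + s) = κ) {t : ZMod n}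
    (ht : ∀ j ∈ admissibleSet n S, (j : ZMod n) * t = 0) : t = 0 := by
  have h : ZMod.dft (fun v => f (v + t)) = ZMod.dft f := by
    ext k
    rw [dft_comp_add_right]
    by_cases hk : k = 0
    · simp [hk]
    by_cases hadm : k.val ∈ admissibleSet n S
    · have := ht _ hadm
      rw [ZMod.natCast_zmod_val] at this
      rw [this, AddChar.map_zero_eq_one, one_mul]
    · rw [dft_eq_zero_of_not_admissible hf hk hadm, mul_zero]
  have := hinj (congrFun (ZMod.dft.injective h) 0)
  simpa using this

/-- If `t` has order three and no admissible element annihilates `t`, then the sums of `f` over the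
cosets of `⟨t⟩` are constant. -/
theorem natCast_mul_add_add_eq {S : Finset (ZMod n)} {f : ZMod n → ℂ} {κ : ℂ}
    (hf : ∀ v, ∑ s ∈ S, f (v + s) = κ) {t : ZMod n} (ht3 : 3 * t = 0)
    (ht : ∀ j ∈ admissibleSet n S, (j : ZMod n) * t ≠ 0) :
    (n : ℂ) * (f 0 + f t + f (t + t)) = 3 * ∑ v, f v := by
  -- The coset sum multiplies the coefficient at `k` by `1 + w + w ^ 2`, where `w` is a nontrivial
  -- cube root of unity when `k` is admissible.
  have h0 : ∀ k ≠ 0, ZMod.dft (f + (fun v => f (v + t)) + (fun v => f (v + (t + t)))) k = 0 := by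
    intro k hk
    rw [map_add, map_add, Pi.add_apply, Pi.add_apply, dft_comp_add_right, dft_comp_add_right]
    by_cases hadm : k.val ∈ admissibleSet n S
    · have h1 := ht _ hadm
      rw [ZMod.natCast_zmod_val] at h1
      have h2 : (ZMod.stdAddChar (k * t) : ℂ) ≠ 1 := fun h => h1 <|
        ZMod.injective_stdAddChar (h.trans (AddChar.map_zero_eq_one _).symm)
      have h3 : (ZMod.stdAddChar (k * t) : ℂ) ^ 3 = 1 := by
        rw [← AddChar.map_nsmul_eq_pow, ← AddChar.map_zero_eq_one (ZMod.stdAddChar (N := n))]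
        congr 1
        rw [nsmul_eq_mul]
        push_cast
        linear_combination k * ht3
      rw [mul_add, AddChar.map_add_eq_mul]
      generalize (ZMod.stdAddChar (k * t) : ℂ) = w at *
      have : 1 + w + w * w = 0 := by
        have : (w - 1) * (1 + w + w * w) = 0 := by linear_combination h3
        exact (mul_eq_zero.1 this).resolve_left (sub_ne_zero.2 h2)
      linear_combination ZMod.dft f k * this
    · rw [dft_eq_zero_of_not_admissible hf hk hadm]
      simp
  have h := natCast_mul_eq_sum_of_dft_eq_zero h0 0
  simp only [Pi.add_apply, zero_add, sum_add_distrib] at h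
  have hs : ∀ r : ZMod n, ∑ v, f (v + r) = ∑ v, f v := fun r =>
    Equiv.sum_comp (Equiv.addRight r) f
  rw [hs, hs] at h
  rw [h]
  ring

theorem neighborFinset_circulantGraph_sum {S : Finset (ZMod n)}
    [DecidableRel (SimpleGraph.circulantGraph (S : Set (ZMod n))).Adj]
    (h0 : 0 ∉ S) (hneg : ∀ s ∈ S, -s ∈ S) (ℓ : ZMod n → ℕ) (v : ZMod n) :
    ∑ u ∈ (SimpleGraph.circulantGraph (S : Set (ZMod n))).neighborFinset v, ℓ u =
      ∑ s ∈ S, ℓ (v + s) := by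
  symm
  refine sum_bij (fun s _ => v + s) (fun s hs => ?_) (fun s _ s' _ h => add_left_cancel h)
    (fun u hu => ?_) (fun _ _ => rfl)
  · rw [SimpleGraph.mem_neighborFinset, SimpleGraph.circulantGraph_adj]
    refine ⟨fun h => h0 ?_, Or.inr (by simpa using hs)⟩
    rwa [left_eq_add.1 h] at hs
  · rw [SimpleGraph.mem_neighborFinset, SimpleGraph.circulantGraph_adj] at hu
    refine ⟨u - v, ?_, by ring⟩
    rcases hu.2 with h | h
    · simpa using hneg _ h
    · simpa using h

theorem sum_labels {ℓ : ZMod n → ℕ}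
    (hℓ : Set.BijOn ℓ Set.univ (Set.Icc 1 (Fintype.card (ZMod n)))) :
    2 * ∑ v, ℓ v = n * (n + 1) := by
  have h : ∑ v, ℓ v = ∑ i ∈ Icc 1 n, i := by
    refine sum_bij (fun v _ => ℓ v) (fun v _ => ?_) (fun v _ w _ h => ?_) (fun i hi => ?_)
      (fun _ _ => rfl)
    · have := hℓ.mapsTo (Set.mem_univ v)
      rwa [ZMod.card, Set.mem_Icc, ← mem_Icc] at this
    · exact hℓ.injOn (Set.mem_univ _) (Set.mem_univ _) h
    · obtain ⟨v, -, hv⟩ := hℓ.surjOn (by rwa [ZMod.card, Set.mem_Icc, ← mem_Icc] : i ∈ _)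
      exact ⟨v, mem_univ _, hv⟩
  have h2 : ∀ m : ℕ, 2 * ∑ i ∈ Icc 1 m, i = m * (m + 1) := fun m => by
    induction m with
    | zero => rfl
    | succ m ih => rw [sum_Icc_succ_top (by omega), mul_add, ih]; ring
  rw [h, h2]

/-- What is used of the distance magic property: the admissible elements have no common
annihilator, and for even `n` one of them annihilates the elements of order three. -/
theorem IsDistanceMagic.admissible {S : Finset (ZMod n)}
    [DecidableRel (SimpleGraph.circulantGraph (S : Set (ZMod n))).Adj]
    (h0 : 0 ∉ S) (hneg : ∀ s ∈ S, -s ∈ S)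
    (h : IsDistanceMagic (SimpleGraph.circulantGraph (S : Set (ZMod n)))) :
    (∀ t : ZMod n, (∀ j ∈ admissibleSet n S, (j : ZMod n) * t = 0) → t = 0) ∧
    (Even n → ∀ t : ZMod n, 3 * t = 0 → ∃ j ∈ admissibleSet n S, (j : ZMod n) * t = 0) := by
  obtain ⟨ℓ, hℓ, κ, -, hκ⟩ := h
  have hf : ∀ v, ∑ s ∈ S, (fun v => (ℓ v : ℂ)) (v + s) = (κ : ℂ) := fun v => by
    rw [← hκ v, neighborFinset_circulantGraph_sum h0 hneg]
    push_cast
    rfl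
  have hinj : Function.Injective (fun v => (ℓ v : ℂ)) := fun v w hvw =>
    hℓ.injOn (Set.mem_univ _) (Set.mem_univ _) (Nat.cast_injective hvw)
  refine ⟨fun t => eq_zero_of_forall_admissible_mul_eq_zero hinj hf, fun hn t ht3 => ?_⟩
  by_contra! hcon
  have h1 := natCast_mul_add_add_eq (f := fun v => (ℓ v : ℂ)) hf ht3 hcon
  have h2 := sum_labels hℓ
  -- After cancelling `n`, the right side `3 * (n + 1)` is odd for even `n` and the left side is
  -- even.
  have h3 : n * (2 * (ℓ 0 + ℓ t + ℓ (t + t))) = n * (3 * (n + 1)) := by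
    have h1' : n * (ℓ 0 + ℓ t + ℓ (t + t)) = 3 * ∑ v, ℓ v := by exact_mod_cast h1
    linarith
  have h4 := Nat.eq_of_mul_eq_mul_left (Nat.pos_of_ne_zero (NeZero.ne n)) h3
  obtain ⟨m, rfl⟩ := hn
  omega

end

/-! ### Admissible elements against an exceptional triple -/

/-- The congruence conditions modulo `2`, `3` and `5` on the connection set that are forced by an
admissible element of type 3. -/
structure IsExceptionalTriple (A B C : ℤ) : Prop where
  three_left : 3 ∣ A
  three_mid : 3 ∣ B
  three_right : ¬ 3 ∣ C
  five_left : ¬ 5 ∣ A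
  five_mid : ¬ 5 ∣ B
  five_right : 5 ∣ C
  five_add : ¬ 5 ∣ A + B
  five_sub : ¬ 5 ∣ A - B
  two_left : ¬ 2 ∣ A + C
  two_mid : ¬ 2 ∣ B + C

/-- The conditions on the multiples force `u` to be prime to `3` and `5`, so divisibility by these
cancels; non-divisibility always passes to a factor. -/
theorem IsExceptionalTriple.of_mul {u A B C : ℤ} (h : IsExceptionalTriple (u * A) (u * B) (u * C)) :
    IsExceptionalTriple A B C := by
  have h3 : IsCoprime (3 : ℤ) u := (Prime.coprime_iff_not_dvd Int.prime_three).2 fun hu =>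
    h.three_right (hu.mul_right C)
  have h5 : IsCoprime (5 : ℤ) u :=
    (Prime.coprime_iff_not_dvd (Nat.prime_iff_prime_int.1 Nat.prime_five)).2 fun hu =>
      h.five_left (hu.mul_right A)
  exact
    { three_left := h3.dvd_of_dvd_mul_left h.three_left
      three_mid := h3.dvd_of_dvd_mul_left h.three_mid
      three_right := fun hC => h.three_right (hC.mul_left u)
      five_left := fun hA => h.five_left (hA.mul_left u)
      five_mid := fun hB => h.five_mid (hB.mul_left u)
      five_right := h5.dvd_of_dvd_mul_left h.five_right
      five_add := fun hd => h.five_add (by rw [← mul_add]; exact hd.mul_left u)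
      five_sub := fun hd => h.five_sub (by rw [← mul_sub]; exact hd.mul_left u)
      two_left := fun hd => h.two_left (by rw [← mul_add]; exact hd.mul_left u)
      two_mid := fun hd => h.two_mid (by rw [← mul_add]; exact hd.mul_left u) }

/-- Elements of order four cannot occur next to two antipodal elements of different parity. -/
theorem false_of_odd {n : ℕ} {j k l : ℤ} (hk4 : (n : ℤ) ∣ 4 * (j * k)) (hk2 : ¬ (n : ℤ) ∣ 2 * (j * k))
    (hl : ¬ 2 ∣ l) (hjl : (n : ℤ) ∣ 2 * (j * l)) : False := by
  obtain ⟨d, hd⟩ : Odd l := by rwa [← Int.not_even_iff_odd, even_iff_two_dvd]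
  refine hk2 ?_
  -- Here `l = 2 * d + 1`.
  have : 2 * (j * k) = k * (2 * (j * l)) - d * (4 * (j * k)) := by rw [hd]; ring
  rw [this]
  exact dvd_sub (hjl.mul_left _) (hk4.mul_left _)

section

variable {n : ℕ} [NeZero n]

theorem stdAddChar_intCast_eq_one_iff {k : ℤ} :
    (ZMod.stdAddChar (k : ZMod n) : ℂ) = 1 ↔ (n : ℤ) ∣ k := by
  rw [← ZMod.intCast_zmod_eq_zero_iff_dvd, ← AddChar.map_zero_eq_one (ZMod.stdAddChar (N := n))]
  exact ZMod.injective_stdAddChar.eq_iff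

theorem stdAddChar_intCast_pow {k : ℤ} (q : ℕ) :
    (ZMod.stdAddChar (k : ZMod n) : ℂ) ^ q = ZMod.stdAddChar ((q * k : ℤ) : ZMod n) := by
  rw [← AddChar.map_nsmul_eq_pow, nsmul_eq_mul]
  push_cast
  rfl

theorem stdAddChar_intCast_pow_eq_one_iff {k : ℤ} {q : ℕ} :
    (ZMod.stdAddChar (k : ZMod n) : ℂ) ^ q = 1 ↔ (n : ℤ) ∣ q * k := by
  rw [stdAddChar_intCast_pow, stdAddChar_intCast_eq_one_iff]

theorem stdAddChar_ne_zero (x : ZMod n) : (ZMod.stdAddChar x : ℂ) ≠ 0 := by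
  rw [ZMod.stdAddChar_apply]
  exact Circle.coe_ne_zero _

/-- Twice the sum of the cosines of `2πk/n`, `2πl/n`, `2πm/n`, written as a sum of six roots of
unity, vanishes. -/
def CosSumEqZero (n : ℕ) [NeZero n] (k l m : ℤ) : Prop :=
  (ZMod.stdAddChar (k : ZMod n) : ℂ) + (ZMod.stdAddChar (k : ZMod n) : ℂ)⁻¹ +
    ((ZMod.stdAddChar (l : ZMod n) : ℂ) + (ZMod.stdAddChar (l : ZMod n) : ℂ)⁻¹) +
    ((ZMod.stdAddChar (m : ZMod n) : ℂ) + (ZMod.stdAddChar (m : ZMod n) : ℂ)⁻¹) = 0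

theorem stdAddChar_pow_eq_one {k : ℤ} {p q : ℕ} (hn : n = p * q) (hk : (p : ℤ) ∣ k) :
    (ZMod.stdAddChar (k : ZMod n) : ℂ) ^ q = 1 := by
  rw [stdAddChar_intCast_pow_eq_one_iff]
  nth_rewrite 1 [hn]
  push_cast
  rw [mul_comm]
  exact mul_dvd_mul_left _ hk

theorem stdAddChar_pow_eq_one_iff {k : ℤ} {p q : ℕ} (hn : n = p * q) :
    (ZMod.stdAddChar (k : ZMod n) : ℂ) ^ q = 1 ↔ (p : ℤ) ∣ k := by
  have hq : (q : ℤ) ≠ 0 := by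
    rintro h
    exact NeZero.ne n (by rw [hn, Nat.cast_eq_zero.1 h, mul_zero])
  rw [stdAddChar_intCast_pow_eq_one_iff]
  nth_rewrite 1 [hn]
  push_cast
  rw [mul_comm, mul_dvd_mul_iff_left hq]

theorem stdAddChar_pow_self (k : ℤ) {m : ℕ} (hn : n = m) :
    (ZMod.stdAddChar (k : ZMod n) : ℂ) ^ m = 1 := by
  rw [stdAddChar_intCast_pow_eq_one_iff, hn]
  exact dvd_mul_right _ _

theorem ne_zero_of_eq_mul {p q : ℕ} (hn : n = p * q) : q ≠ 0 := by
  rintro rfl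
  exact NeZero.ne n hn

theorem not_dvd_mul_of_prime {p : ℤ} (hp : Prime p) {j k : ℤ} (hj : ¬ p ∣ j) (hk : ¬ p ∣ k) :
    ¬ p ∣ j * k := fun h => (hp.dvd_or_dvd h).elim hj hk

theorem Int.prime_five : Prime (5 : ℤ) := Nat.prime_iff_prime_int.1 Nat.prime_five

variable {A B C j : ℤ}

theorem three_dvd_of_nine_dvd (hT : IsExceptionalTriple A B C)
    (hj : CosSumEqZero n (j * A) (j * B) (j * C)) (h9 : 9 ∣ n) : 3 ∣ j := by
  obtain ⟨r, hr⟩ := h9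
  have hn : n = 3 * (3 * r) := by rw [hr]; ring
  by_contra h3
  refine false_of_three_dvd (ne_zero_of_eq_mul hn) (dvd_mul_right _ _)
    ((stdAddChar_pow_eq_one_iff hn).2 (hT.three_left.mul_left j))
    ((stdAddChar_pow_eq_one_iff hn).2 (hT.three_mid.mul_left j))
    (stdAddChar_pow_self _ hn) (fun h => ?_) hj
  exact not_dvd_mul_of_prime Int.prime_three h3 hT.three_right ((stdAddChar_pow_eq_one_iff hn).1 h)

/-- The conditions modulo `5` say that `±A, ±B` are the four nonzero residues, so these terms occupy
the four nontrivial classes. -/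
theorem stdAddChar_class_five (hT : IsExceptionalTriple A B C) (h5 : ¬ 5 ∣ j) {q : ℕ}
    (hn : n = 5 * q) :
    (ZMod.stdAddChar ((j * C : ℤ) : ZMod n) : ℂ) ^ q = 1 ∧
    (ZMod.stdAddChar ((j * A : ℤ) : ZMod n) : ℂ) ^ q ≠ 1 ∧
    (ZMod.stdAddChar ((j * B : ℤ) : ZMod n) : ℂ) ^ q ≠ 1 ∧
    (ZMod.stdAddChar ((j * B : ℤ) : ZMod n) : ℂ) ^ q ≠
      (ZMod.stdAddChar ((j * A : ℤ) : ZMod n) : ℂ) ^ q ∧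
    ((ZMod.stdAddChar ((j * B : ℤ) : ZMod n) : ℂ) ^ q)⁻¹ ≠
      (ZMod.stdAddChar ((j * A : ℤ) : ZMod n) : ℂ) ^ q := by
  have hp := Int.prime_five
  refine ⟨(stdAddChar_pow_eq_one_iff hn).2 (hT.five_right.mul_left j), fun h => ?_, fun h => ?_,
    fun h => ?_, fun h => ?_⟩
  · exact not_dvd_mul_of_prime hp h5 hT.five_left ((stdAddChar_pow_eq_one_iff hn).1 h)
  · exact not_dvd_mul_of_prime hp h5 hT.five_mid ((stdAddChar_pow_eq_one_iff hn).1 h)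
  · refine not_dvd_mul_of_prime hp h5 hT.five_sub ((stdAddChar_pow_eq_one_iff hn).1 ?_)
    rw [mul_sub, Int.cast_sub, AddChar.map_sub_eq_div, div_pow, h,
      div_self (pow_ne_zero _ (stdAddChar_ne_zero _))]
  · refine not_dvd_mul_of_prime hp h5 hT.five_add ((stdAddChar_pow_eq_one_iff hn).1 ?_)
    rw [mul_add, Int.cast_add, AddChar.map_add_eq_mul, mul_pow, ← h,
      inv_mul_cancel₀ (pow_ne_zero _ (stdAddChar_ne_zero _))]

theorem five_dvd_of_twentyfive_dvd (hT : IsExceptionalTriple A B C)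
    (hj : CosSumEqZero n (j * A) (j * B) (j * C)) (h25 : 25 ∣ n) : 5 ∣ j := by
  obtain ⟨r, hr⟩ := h25
  have hn : n = 5 * (5 * r) := by rw [hr]; ring
  by_contra h5
  obtain ⟨h1, h2, -, h3, h4⟩ := stdAddChar_class_five hT h5 hn
  exact false_of_five_dvd (ne_zero_of_eq_mul hn) (dvd_mul_right _ _) h1
    (stdAddChar_pow_self _ hn) (stdAddChar_pow_self _ hn) h2 h3 h4 hj

/-- The terms of `A` and `B` have order dividing `10`, that of `C` order dividing `6`. The latter
does not square to `1`, since then `(z + z⁻¹) ^ 2` would be `4` instead of `1`. -/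
theorem dvd_thirty_mul_of_not_five_dvd (hT : IsExceptionalTriple A B C)
    (hj : CosSumEqZero n (j * A) (j * B) (j * C)) (h5n : 5 ∣ n) (h25 : ¬ 25 ∣ n) (h5 : ¬ 5 ∣ j) :
    ((n : ℤ) ∣ 30 * (j * A) ∧ (n : ℤ) ∣ 30 * (j * B) ∧ (n : ℤ) ∣ 30 * (j * C)) ∧
      ¬ (n : ℤ) ∣ 2 * (j * C) := by
  obtain ⟨q, hn⟩ := h5n
  have hq : ¬ 5 ∣ q := by omega
  obtain ⟨h1, h2, h2', h3, h4⟩ := stdAddChar_class_five hT h5 hn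
  have hA := pow_ten_eq_one_of_not_five_dvd (ne_zero_of_eq_mul hn) hq h1
    (stdAddChar_pow_self _ hn) (stdAddChar_pow_self _ hn) h2 h3 h4 h2' hj
  have hB := pow_ten_eq_one_of_not_five_dvd (ne_zero_of_eq_mul hn) hq h1
    (stdAddChar_pow_self _ hn) (stdAddChar_pow_self _ hn) h2' h3.symm
    (fun h => h4 (by rw [← h, inv_inv])) h2
    (by rw [← hj]; ring)
  have hC := stdAddChar_intCast_pow_eq_one_iff.1
    (pow_six_eq_one_of_add_inv_sq (stdAddChar_ne_zero _) hA.2)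
  have hA' := stdAddChar_intCast_pow_eq_one_iff.1 hA.1
  have hB' := stdAddChar_intCast_pow_eq_one_iff.1 hB.1
  push_cast at hA' hB' hC
  refine ⟨⟨?_, ?_, ?_⟩, fun h => ?_⟩
  · exact (hA'.mul_left 3).trans (dvd_of_eq (by ring))
  · exact (hB'.mul_left 3).trans (dvd_of_eq (by ring))
  · exact (hC.mul_left 5).trans (dvd_of_eq (by ring))
  · have hz := stdAddChar_intCast_pow_eq_one_iff.2 (by exact_mod_cast h)
    have h0 := stdAddChar_ne_zero ((j * C : ℤ) : ZMod n)
    have h2 := hA.2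
    rw [add_sq, inv_pow, hz, mul_assoc, mul_inv_cancel₀ h0] at h2
    norm_num at h2

/-- As `15` divides `j * A` and `j * B`, their terms have order prime to `15`; if `3 ∤ j`, the
classes modulo `3` would make them sum to `±1`. -/
theorem three_dvd_of_five_dvd (hT : IsExceptionalTriple A B C)
    (hj : CosSumEqZero n (j * A) (j * B) (j * C)) (h30 : 30 ∣ n) (h9 : ¬ 9 ∣ n)
    (h25 : ¬ 25 ∣ n) (h5 : 5 ∣ j) : 3 ∣ j := by
  by_contra h3
  obtain ⟨r, hr⟩ := h30
  have hn : n = 3 * (10 * r) := by rw [hr]; ring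
  have hn' : n = 15 * (2 * r) := by rw [hr]; ring
  have h15 : ∀ k : ℤ, 3 ∣ k → ((15 : ℕ) : ℤ) ∣ j * k := fun k hk => by
    push_cast
    exact mul_dvd_mul h5 hk
  refine false_of_add_inv_eq_one (ne_zero_of_eq_mul hn') (dvd_mul_right _ _) (by omega) (by omega)
    (stdAddChar_pow_eq_one hn' (h15 A hT.three_left))
    (stdAddChar_pow_eq_one hn' (h15 B hT.three_mid))
    (exists_of_not_three_dvd (ne_zero_of_eq_mul hn) (by omega)
    ((stdAddChar_pow_eq_one_iff hn).2 (hT.three_left.mul_left j))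
    ((stdAddChar_pow_eq_one_iff hn).2 (hT.three_mid.mul_left j))
    (stdAddChar_pow_self _ hn) (fun h => ?_) hj)
  exact not_dvd_mul_of_prime Int.prime_three h3 hT.three_right ((stdAddChar_pow_eq_one_iff hn).1 h)

theorem dvd_of_add_inv_eq_zero {k : ℤ}
    (h : (ZMod.stdAddChar (k : ZMod n) : ℂ) + (ZMod.stdAddChar (k : ZMod n) : ℂ)⁻¹ = 0) :
    (n : ℤ) ∣ 4 * k ∧ ¬ (n : ℤ) ∣ 2 * k := by
  have h0 := stdAddChar_ne_zero (k : ZMod n)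
  have h2 : (ZMod.stdAddChar (k : ZMod n) : ℂ) ^ 2 = -1 := by
    field_simp at h
    linear_combination h
  have h4 : (ZMod.stdAddChar (k : ZMod n) : ℂ) ^ 4 = 1 := by
    rw [pow_mul _ 2 2, h2]; norm_num
  refine ⟨by simpa using stdAddChar_intCast_pow_eq_one_iff.1 h4, fun hd => ?_⟩
  have := (stdAddChar_intCast_pow_eq_one_iff (q := 2)).2 (by exact_mod_cast hd)
  rw [h2] at this
  norm_num at this

theorem dvd_of_add_inv_add_eq_zero {k l : ℤ}
    (h : (ZMod.stdAddChar (k : ZMod n) : ℂ) + (ZMod.stdAddChar (k : ZMod n) : ℂ)⁻¹ +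
      ((ZMod.stdAddChar (l : ZMod n) : ℂ) + (ZMod.stdAddChar (l : ZMod n) : ℂ)⁻¹) = 0) :
    ((n : ℤ) ∣ 2 * (k - l) ∧ ¬ (n : ℤ) ∣ k - l) ∨ ((n : ℤ) ∣ 2 * (k + l) ∧ ¬ (n : ℤ) ∣ k + l) := by
  have key : ∀ m : ℤ, (ZMod.stdAddChar (m : ZMod n) : ℂ) = -1 →
      (n : ℤ) ∣ 2 * m ∧ ¬ (n : ℤ) ∣ m := fun m hm => by
    refine ⟨?_, fun hd => ?_⟩
    · exact_mod_cast stdAddChar_intCast_pow_eq_one_iff (n := n) (q := 2).1 (by rw [hm]; norm_num)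
    · rw [stdAddChar_intCast_eq_one_iff.2 hd] at hm
      norm_num at hm
  rcases eq_neg_or_mul_eq_neg_one (stdAddChar_ne_zero _) (stdAddChar_ne_zero _) h with h | h
  · left
    refine key _ ?_
    rw [Int.cast_sub, AddChar.map_sub_eq_div, h, neg_div, div_self (stdAddChar_ne_zero _)]
  · right
    refine key _ ?_
    rw [Int.cast_add, AddChar.map_add_eq_mul, h]

/-- Some cosine vanishes. It is not that of `A` or `B`: the other two terms would be antipodal up to
inversion, contradicting the parity of `B + C` or `A + C`. -/
theorem dvd_of_fifteen_dvd (hT : IsExceptionalTriple A B C)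
    (hj : CosSumEqZero n (j * A) (j * B) (j * C)) (h30 : 30 ∣ n) (h9 : ¬ 9 ∣ n)
    (h25 : ¬ 25 ∣ n) (h15 : 15 ∣ j) :
    ((n : ℤ) ∣ 4 * (j * C) ∧ ¬ (n : ℤ) ∣ 2 * (j * C)) ∧
    (((n : ℤ) ∣ 2 * (j * A - j * B) ∧ ¬ (n : ℤ) ∣ j * A - j * B) ∨
      ((n : ℤ) ∣ 2 * (j * A + j * B) ∧ ¬ (n : ℤ) ∣ j * A + j * B)) := by
  obtain ⟨r, hr⟩ := h30
  have hn : n = 15 * (2 * r) := by rw [hr]; ring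
  have h15' : ∀ k : ℤ, ((15 : ℕ) : ℤ) ∣ j * k := fun k => h15.mul_right k
  have hsub : ∀ k l : ℤ, ¬ 2 ∣ k + l → ¬ 2 ∣ k - l := by omega
  have key : ∀ k l m : ℤ, ¬ 2 ∣ l + m →
      (ZMod.stdAddChar ((j * k : ℤ) : ZMod n) : ℂ) +
        (ZMod.stdAddChar ((j * k : ℤ) : ZMod n) : ℂ)⁻¹ = 0 →
      (ZMod.stdAddChar ((j * l : ℤ) : ZMod n) : ℂ) +
        (ZMod.stdAddChar ((j * l : ℤ) : ZMod n) : ℂ)⁻¹ +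
      ((ZMod.stdAddChar ((j * m : ℤ) : ZMod n) : ℂ) +
        (ZMod.stdAddChar ((j * m : ℤ) : ZMod n) : ℂ)⁻¹) = 0 → False := by
    intro k l m hlm h1 h2
    obtain ⟨h4, h2'⟩ := dvd_of_add_inv_eq_zero h1
    rcases dvd_of_add_inv_add_eq_zero h2 with ⟨h, -⟩ | ⟨h, -⟩
    · exact false_of_odd h4 h2' (hsub _ _ hlm) (by rwa [mul_sub])
    · exact false_of_odd h4 h2' hlm (by rwa [mul_add])
  rcases exists_add_inv_eq_zero (ne_zero_of_eq_mul hn) (dvd_mul_right _ _) (by omega) (by omega)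
    (stdAddChar_pow_eq_one hn (h15' A)) (stdAddChar_pow_eq_one hn (h15' B))
    (stdAddChar_pow_eq_one hn (h15' C)) hj with h | h | h
  · exact (key A B C hT.two_mid h (by rw [← hj, h, zero_add])).elim
  · exact (key B A C hT.two_left h (by rw [← hj, h, add_zero])).elim
  · exact ⟨dvd_of_add_inv_eq_zero h, dvd_of_add_inv_add_eq_zero (by rw [← hj, h, add_zero])⟩

end

/-! ### Passing from the connection set to integer representatives -/

section

variable {n : ℕ} [NeZero n]

theorem pairwise_ne_of_card_eq_six {α : Type*} [DecidableEq α] {S : Finset α} {a b c d e f : α}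
    (hS : S = {a, b, c, d, e, f}) (hcard : S.card = 6) :
    a ∉ ({b, c, d, e, f} : Finset α) ∧ b ∉ ({c, d, e, f} : Finset α) ∧
    c ∉ ({d, e, f} : Finset α) ∧ d ∉ ({e, f} : Finset α) ∧ e ∉ ({f} : Finset α) := by
  subst hS
  have h2 := card_le_two (a := e) (b := f)
  have h3 := card_le_three (a := d) (b := e) (c := f)
  have h4 := card_le_four (a := c) (b := d) (c := e) (d := f)
  have h5 := card_le_five (a := b) (b := c) (c := d) (d := e) (e := f)
  have i5 := card_insert_le a ({b, c, d, e, f} : Finset α)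
  have i4 := card_insert_le b ({c, d, e, f} : Finset α)
  have i3 := card_insert_le c ({d, e, f} : Finset α)
  have i2 := card_insert_le d ({e, f} : Finset α)
  have i1 := card_insert_le e ({f} : Finset α)
  refine ⟨fun h => ?_, fun h => ?_, fun h => ?_, fun h => ?_, fun h => ?_⟩ <;>
    have := congrArg card (insert_eq_of_mem h) <;> simp only [card_singleton] at * <;> omega

theorem sum_eq_of_card_eq_six {n : ℕ} {S : Finset (ZMod n)} {a b c : ZMod n}
    (hS : S = {a, -a, b, -b, c, -c}) (hcard : S.card = 6) (f : ZMod n → ℂ) :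
    ∑ s ∈ S, f s = f a + f (-a) + (f b + f (-b)) + (f c + f (-c)) := by
  obtain ⟨h1, h2, h3, h4, h5⟩ := pairwise_ne_of_card_eq_six hS hcard
  rw [hS, sum_insert h1, sum_insert h2, sum_insert h3, sum_insert h4, sum_insert h5,
    sum_singleton]
  ring

theorem cosSumEqZero_of_mem_admissibleSet {S : Finset (ZMod n)} {a b c : ZMod n} {j : ℕ}
    (hS : S = {a, -a, b, -b, c, -c}) (hcard : S.card = 6) (hj : j ∈ admissibleSet n S) :
    CosSumEqZero n (j * a.val) (j * b.val) (j * c.val) := by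
  have h := (mem_admissibleSet_iff.1 hj).2
  rw [sum_eq_of_card_eq_six hS hcard (fun s => (ZMod.stdAddChar ((j : ZMod n) * s) : ℂ))] at h
  simpa [CosSumEqZero, AddChar.map_neg_eq_inv] using h

theorem eq_zero_of_forall_mul_eq_zero {n : ℕ} {S : Finset (ZMod n)}
    (hgen : AddSubgroup.closure (S : Set (ZMod n)) = ⊤) {k : ZMod n}
    (hk : ∀ s ∈ S, k * s = 0) : k = 0 := by
  have h : AddSubgroup.closure (S : Set (ZMod n)) ≤ (AddMonoidHom.mulLeft k).ker :=
    (AddSubgroup.closure_le _).2 fun s hs => hk s hs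
  rw [hgen] at h
  simpa using h (AddSubgroup.mem_top (1 : ZMod n))

theorem natCast_dvd_mul_val_iff {k : ℤ} {s : ZMod n} :
    (n : ℤ) ∣ k * s.val ↔ (k : ZMod n) * s = 0 := by
  rw [← ZMod.intCast_zmod_eq_zero_iff_dvd]
  simp

theorem dvd_of_forall_dvd_mul {S : Finset (ZMod n)} {a b c : ZMod n}
    (hS : S = {a, -a, b, -b, c, -c}) (hgen : AddSubgroup.closure (S : Set (ZMod n)) = ⊤) {k : ℤ}
    (ha : (n : ℤ) ∣ k * a.val) (hb : (n : ℤ) ∣ k * b.val) (hc : (n : ℤ) ∣ k * c.val) :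
    (n : ℤ) ∣ k := by
  rw [natCast_dvd_mul_val_iff] at ha hb hc
  rw [← ZMod.intCast_zmod_eq_zero_iff_dvd]
  refine eq_zero_of_forall_mul_eq_zero hgen fun s hs => ?_
  rw [hS] at hs
  simp only [mem_insert, mem_singleton] at hs
  rcases hs with rfl | rfl | rfl | rfl | rfl | rfl <;> simp [ha, hb, hc]

/-- The absolutely least representative of `j * s`. -/
def minRep (n j : ℕ) (s : ZMod n) : ℤ := ((j : ZMod n) * s).valMinAbs

theorem dvd_minRep_sub (j : ℕ) (s : ZMod n) : (n : ℤ) ∣ j * s.val - minRep n j s := by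
  rw [← ZMod.intCast_zmod_eq_zero_iff_dvd]
  simp [minRep]

theorem dvd_mul_minRep_iff {j : ℕ} {s : ZMod n} {k : ℤ} :
    (n : ℤ) ∣ k * minRep n j s ↔ (n : ℤ) ∣ k * (j * s.val) := by
  refine (dvd_iff_dvd_of_dvd_sub ?_).symm
  rw [← mul_sub]
  exact (dvd_minRep_sub j s).mul_left k

theorem reducedAngle_eq_iff {j : ℕ} {s : ZMod n} {r : ℚ} :
    reducedAngle n j s = r ↔ (2 * |minRep n j s| : ℤ) = r * n := by
  have hn : (n : ℚ) ≠ 0 := Nat.cast_ne_zero.2 (NeZero.ne n)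
  rw [reducedAngle, div_eq_iff hn, minRep]
  push_cast
  rfl

theorem IsAdmissibleType3.exists_minRep {S : Finset (ZMod n)} {j : ℕ}
    (h : IsAdmissibleType3 n S j) : ∃ a b c : ZMod n, S = {a, -a, b, -b, c, -c} ∧
      ((10 * |minRep n j a| = n ∧ 10 * |minRep n j b| = 3 * n ∧ 3 * |minRep n j c| = n) ∨
      (5 * |minRep n j a| = n ∧ 5 * |minRep n j b| = 2 * n ∧ 6 * |minRep n j c| = n)) := by
  obtain ⟨-, r₁, r₂, r₃, ⟨-, -, s₁, s₂, s₃, hS, h1, h2, h3⟩, h⟩ := h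
  rw [reducedAngle_eq_iff] at h1 h2 h3
  rcases h with ⟨rfl, rfl, rfl⟩ | ⟨rfl, rfl, rfl⟩
  · refine ⟨s₁, s₂, s₃, hS, Or.inl ⟨?_, ?_, ?_⟩⟩ <;> qify <;> push_cast at h1 h2 h3 <;> linarith
  · refine ⟨s₂, s₃, s₁, ?_, Or.inr ⟨?_, ?_, ?_⟩⟩
    · rw [hS]; ext; simp only [mem_insert, mem_singleton]; tauto
    all_goals qify; push_cast at h1 h2 h3; linarith

end

/-! ### From type 3 to the dichotomy, and recognition of type 1 -/

section

variable {n : ℕ} [NeZero n]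

theorem IsAdmissibleType3.dvd_thirty_mul {S : Finset (ZMod n)} {j : ℕ}
    (hgen : AddSubgroup.closure (S : Set (ZMod n)) = ⊤) (h : IsAdmissibleType3 n S j) :
    (n : ℤ) ∣ 30 * j := by
  obtain ⟨a, b, c, hS, h⟩ := h.exists_minRep
  have key : ∀ s : ZMod n, (n : ℤ) ∣ 30 * |minRep n j s| → (n : ℤ) ∣ 30 * j * s.val := by
    intro s hs
    rw [mul_assoc, ← dvd_mul_minRep_iff]
    rwa [← abs_dvd_abs, abs_mul, abs_abs, ← abs_mul, abs_dvd_abs] at hs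
  rcases h with ⟨h1, h2, h3⟩ | ⟨h1, h2, h3⟩
  · exact dvd_of_forall_dvd_mul hS hgen (key a ⟨3, by linarith⟩) (key b ⟨9, by linarith⟩)
      (key c ⟨10, by linarith⟩)
  · exact dvd_of_forall_dvd_mul hS hgen (key a ⟨6, by linarith⟩) (key b ⟨12, by linarith⟩)
      (key c ⟨5, by linarith⟩)

/-- With `n = 30 * g` and `j = g * u`, the numbers `p, q, r` are the halved type 3 angles in units
of `1/30`. So `u * a, u * b, u * c` are `±p, ±q, ±r` modulo `30`, with the angle of denominator `3`
last. -/
theorem isExceptionalTriple_of_eq_abs {g a b c p q r : ℤ} (hg : 0 < g)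
    (hT : (p = 3 ∧ q = 9 ∧ r = 10) ∨ (p = 6 ∧ q = 12 ∧ r = 5)) {a' b' c' u : ℤ}
    (ha : |a'| = p * g) (hb : |b'| = q * g) (hc : |c'| = r * g)
    (ha' : 30 * g ∣ g * u * a - a') (hb' : 30 * g ∣ g * u * b - b')
    (hc' : 30 * g ∣ g * u * c - c') : IsExceptionalTriple a b c := by
  have key : ∀ s s' t : ℤ, |s'| = t * g → 30 * g ∣ g * u * s - s' →
      ∃ k, u * s = t + 30 * k ∨ u * s = -t + 30 * k := by
    intro s s' t hs ⟨k, hk⟩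
    refine ⟨k, ?_⟩
    rcases eq_or_eq_neg_of_abs_eq hs with h | h
    · left
      refine mul_left_cancel₀ hg.ne' ?_
      linear_combination hk + h
    · right
      refine mul_left_cancel₀ hg.ne' ?_
      linear_combination hk + h
  obtain ⟨k, hk⟩ := key a a' p ha ha'
  obtain ⟨l, hl⟩ := key b b' q hb hb'
  obtain ⟨m, hm⟩ := key c c' r hc hc'
  refine IsExceptionalTriple.of_mul (u := u) ?_
  generalize u * a = x at *
  generalize u * b = y at *
  generalize u * c = z at *
  rcases hT with ⟨rfl, rfl, rfl⟩ | ⟨rfl, rfl, rfl⟩ <;> constructor <;> omega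

theorem IsAdmissibleType3.exists_exceptional {S : Finset (ZMod n)} {j : ℕ}
    (hgen : AddSubgroup.closure (S : Set (ZMod n)) = ⊤) (h : IsAdmissibleType3 n S j) :
    30 ∣ n ∧ ∃ a b c : ZMod n, S = {a, -a, b, -b, c, -c} ∧
      IsExceptionalTriple a.val b.val c.val := by
  have h30 := h.dvd_thirty_mul hgen
  obtain ⟨a, b, c, hS, h⟩ := h.exists_minRep
  obtain ⟨g, rfl⟩ : 30 ∣ n := by omega
  have hg : (0 : ℤ) < g := by
    have := NeZero.ne (30 * g)
    omega
  refine ⟨dvd_mul_right _ _, a, b, c, hS, ?_⟩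
  obtain ⟨u, hu⟩ : (g : ℤ) ∣ j := by
    push_cast at h30
    exact (mul_dvd_mul_iff_left (by norm_num)).1 h30
  have hd := fun s : ZMod (30 * g) => dvd_minRep_sub j s
  rw [hu] at hd
  push_cast at hd h
  rcases h with ⟨h1, h2, h3⟩ | ⟨h1, h2, h3⟩
  · exact isExceptionalTriple_of_eq_abs hg (Or.inl ⟨rfl, rfl, rfl⟩) (by linarith) (by linarith)
      (by linarith) (hd a) (hd b) (hd c)
  · exact isExceptionalTriple_of_eq_abs hg (Or.inr ⟨rfl, rfl, rfl⟩) (by linarith) (by linarith)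
      (by linarith) (hd a) (hd b) (hd c)

/-- The two kinds of admissible elements in the presence of an exceptional triple. -/
theorem admissible_dichotomy {S : Finset (ZMod n)} {a b c : ZMod n}
    (hS : S = {a, -a, b, -b, c, -c}) (hcard : S.card = 6)
    (hgen : AddSubgroup.closure (S : Set (ZMod n)) = ⊤)
    (hT : IsExceptionalTriple a.val b.val c.val) (h30 : 30 ∣ n) (h9 : ¬ 9 ∣ n) (h25 : ¬ 25 ∣ n)
    {j : ℕ} (hj : j ∈ admissibleSet n S) :
    ((n : ℤ) ∣ 30 * j ∧ ¬ (5 : ℤ) ∣ j ∧ ¬ (3 : ℤ) ∣ j) ∨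
    ((15 : ℤ) ∣ j ∧ ((n : ℤ) ∣ 4 * (j * c.val) ∧ ¬ (n : ℤ) ∣ 2 * (j * c.val)) ∧
      (((n : ℤ) ∣ 2 * (j * a.val - j * b.val) ∧ ¬ (n : ℤ) ∣ j * a.val - j * b.val) ∨
      ((n : ℤ) ∣ 2 * (j * a.val + j * b.val) ∧ ¬ (n : ℤ) ∣ j * a.val + j * b.val))) := by
  have hsum := cosSumEqZero_of_mem_admissibleSet hS hcard hj
  by_cases h5 : (5 : ℤ) ∣ j
  · right
    have h3 := three_dvd_of_five_dvd hT hsum h30 h9 h25 h5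
    have h15 : (15 : ℤ) ∣ j := by omega
    exact ⟨h15, dvd_of_fifteen_dvd hT hsum h30 h9 h25 h15⟩
  · left
    obtain ⟨⟨ha, hb, hc⟩, hc2⟩ := dvd_thirty_mul_of_not_five_dvd hT hsum (by omega) h25 h5
    simp only [← mul_assoc (30 : ℤ)] at ha hb hc
    have h := dvd_of_forall_dvd_mul hS hgen ha hb hc
    refine ⟨h, h5, fun h3 => hc2 ?_⟩
    -- As `9 ∤ n`, the single factor `3` of `n` is already supplied by `j`. Then `5 ∣ C` turns `10`
    -- into `2`.
    have h10 : (n : ℤ) ∣ 10 * j := by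
      obtain ⟨q, hq⟩ : 3 ∣ n := by omega
      have hq3 : IsCoprime (3 : ℤ) q := (Prime.coprime_iff_not_dvd Int.prime_three).2 (by omega)
      rw [hq] at h ⊢
      push_cast at h ⊢
      rw [show (30 : ℤ) * j = 3 * (10 * j) by ring, mul_dvd_mul_iff_left three_ne_zero] at h
      exact hq3.mul_dvd (h3.mul_left 10) h
    obtain ⟨d, hd⟩ := hT.five_right
    rw [hd]
    exact (h10.mul_right d).trans (dvd_of_eq (by ring))

theorem exists_isAdmissibleType1_of_abs {S : Finset (ZMod n)} {a b c : ZMod n}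
    (hS : S = {a, -a, b, -b, c, -c}) {j : ℕ} (hj : j ∈ admissibleSet n S)
    (hab : 2 * (|minRep n j a| + |minRep n j b|) = n) (hc : 4 * |minRep n j c| = n)
    (hle : |minRep n j a| ≤ |minRep n j b|) : IsAdmissibleType1 n S j := by
  have hn : (n : ℚ) ≠ 0 := Nat.cast_ne_zero.2 (NeZero.ne n)
  have hn0 : (0 : ℚ) < n := by positivity
  have hr : ∀ s : ZMod n, reducedAngle n j s = 2 * (|minRep n j s| : ℤ) / n := fun s => by
    rw [reducedAngle, minRep]; push_cast; rfl
  have hnn := abs_nonneg (minRep n j a)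
  qify at hab hc hle hnn
  refine ⟨hj, reducedAngle n j a, reducedAngle n j c, reducedAngle n j b,
    ⟨?_, ?_, a, c, b, ?_, rfl, rfl, rfl⟩, ?_, ?_, ?_, ?_⟩
  · rw [hr, hr]; rw [div_le_div_iff_of_pos_right hn0]; push_cast; linarith
  · rw [hr, hr]; rw [div_le_div_iff_of_pos_right hn0]; push_cast; linarith
  · rw [hS]; ext; simp only [mem_insert, mem_singleton]; tauto
  · rw [hr]; push_cast; positivity
  · rw [hr, div_le_iff₀ hn0]; push_cast; linarith
  · rw [hr, div_eq_iff hn]; push_cast; linarith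
  · rw [hr, hr, div_eq_iff hn, sub_mul, div_mul_cancel₀ _ hn]; push_cast; linarith

/-- The relevant `x ∓ y` is an odd multiple of `n / 2` of size at most `n`, hence `±n / 2`; the
bounds on `x` and `y` then fix their signs. -/
theorem two_mul_abs_add_abs_eq {n x y : ℤ} (hn : 0 < n) (hx : -n < 2 * x ∧ 2 * x ≤ n)
    (hy : -n < 2 * y ∧ 2 * y ≤ n) (h : (n ∣ 2 * (x - y) ∧ ¬ n ∣ x - y) ∨
      (n ∣ 2 * (x + y) ∧ ¬ n ∣ x + y)) : 2 * (|x| + |y|) = n := by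
  have key : ∀ z : ℤ, -n ≤ z → z ≤ n → n ∣ 2 * z → ¬ n ∣ z → 2 * z = n ∨ 2 * z = -n := by
    intro z h1 h2 ⟨k, hk⟩ h4
    have hk1 : -2 ≤ k := by nlinarith
    have hk2 : k ≤ 2 := by nlinarith
    interval_cases k
    · exact absurd ⟨-1, by linarith⟩ h4
    · right; linarith
    · exact absurd ⟨0, by linarith⟩ h4
    · left; linarith
    · exact absurd ⟨1, by linarith⟩ h4
  rcases h with ⟨h1, h2⟩ | ⟨h1, h2⟩
  · have := key (x - y) (by omega) (by omega) h1 h2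
    rcases abs_cases x with h | h <;> rcases abs_cases y with h' | h' <;> omega
  · have := key (x + y) (by omega) (by omega) h1 h2
    rcases abs_cases x with h | h <;> rcases abs_cases y with h' | h' <;> omega

theorem isAdmissibleType1_of_dvd {S : Finset (ZMod n)} {a b c : ZMod n}
    (hS : S = {a, -a, b, -b, c, -c}) {j : ℕ} (hj : j ∈ admissibleSet n S)
    (hc4 : (n : ℤ) ∣ 4 * (j * c.val)) (hc2 : ¬ (n : ℤ) ∣ 2 * (j * c.val))
    (hab : ((n : ℤ) ∣ 2 * (j * a.val - j * b.val) ∧ ¬ (n : ℤ) ∣ j * a.val - j * b.val) ∨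
      ((n : ℤ) ∣ 2 * (j * a.val + j * b.val) ∧ ¬ (n : ℤ) ∣ j * a.val + j * b.val)) :
    IsAdmissibleType1 n S j := by
  have hn : (0 : ℤ) < n := by exact_mod_cast Nat.pos_of_ne_zero (NeZero.ne n)
  have hbd : ∀ s : ZMod n, -(n : ℤ) < 2 * minRep n j s ∧ 2 * minRep n j s ≤ n := fun s => by
    have := ZMod.valMinAbs_mem_Ioc ((j : ZMod n) * s)
    rw [Set.mem_Ioc] at this
    rw [minRep]
    omega
  have ha' := dvd_minRep_sub j a
  have hb' := dvd_minRep_sub j b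
  have hadd : (n : ℤ) ∣ (j * a.val + j * b.val) - (minRep n j a + minRep n j b) := by
    rw [add_sub_add_comm]; exact dvd_add ha' hb'
  have hsub : (n : ℤ) ∣ (j * a.val - j * b.val) - (minRep n j a - minRep n j b) := by
    rw [sub_sub_sub_comm]; exact dvd_sub ha' hb'
  have hab' : 2 * (|minRep n j a| + |minRep n j b|) = n := by
    refine two_mul_abs_add_abs_eq hn (hbd a) (hbd b) ?_
    rw [dvd_iff_dvd_of_dvd_sub hadd, dvd_iff_dvd_of_dvd_sub hsub,
      dvd_iff_dvd_of_dvd_sub (by rw [← mul_sub]; exact hadd.mul_left 2 :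
        (n : ℤ) ∣ 2 * (j * a.val + j * b.val) - 2 * (minRep n j a + minRep n j b)),
      dvd_iff_dvd_of_dvd_sub (by rw [← mul_sub]; exact hsub.mul_left 2 :
        (n : ℤ) ∣ 2 * (j * a.val - j * b.val) - 2 * (minRep n j a - minRep n j b))] at hab
    exact hab
  rw [← dvd_mul_minRep_iff] at hc4 hc2
  have hc' : 2 * (|minRep n j c| + |minRep n j c|) = n := by
    refine two_mul_abs_add_abs_eq hn (hbd c) (hbd c) (Or.inr ⟨?_, ?_⟩)
    · convert hc4 using 1; ring
    · rwa [← two_mul]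
  rcases le_total |minRep n j a| |minRep n j b| with h | h
  · exact exists_isAdmissibleType1_of_abs hS hj hab' (by linarith) h
  · refine exists_isAdmissibleType1_of_abs (a := b) (b := a) ?_ hj (by linarith) (by linarith) h
    rw [hS]; ext; simp only [mem_insert, mem_singleton]; tauto

end

/-! ### Exclusion of type 2, and type 1 against `n ∣ 30 * j` -/

section

variable {n : ℕ} [NeZero n]

/-- Type 2 makes `n` three times a sum of two multiples of `15`, so `9 ∣ n`. -/
theorem not_isAdmissibleType2_of_fifteen_dvd {S : Finset (ZMod n)} {j : ℕ} (h15 : 15 ∣ n)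
    (h9 : ¬ 9 ∣ n) (hj : (15 : ℤ) ∣ j) : ¬ IsAdmissibleType2 n S j := by
  rintro ⟨-, r₁, r₂, r₃, ⟨-, -, s₁, s₂, s₃, -, h1, h2, h3⟩, -, -, hr2, hr3⟩
  rw [reducedAngle_eq_iff] at h1 h2 h3
  have h12 : 3 * (|minRep n j s₁| + |minRep n j s₂|) = n := by
    rw [hr2] at h2; qify; push_cast at h1 h2; linarith
  have hd : ∀ s : ZMod n, (15 : ℤ) ∣ |minRep n j s| := fun s => by
    rw [dvd_abs]
    have h : (15 : ℤ) ∣ n := by exact_mod_cast h15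
    exact (dvd_sub_right (hj.mul_right _)).1 (h.trans (dvd_minRep_sub j s))
  have e1 := hd s₁
  have e2 := hd s₂
  omega

theorem five_dvd_iff_of_dvd_abs {x y : ℤ} (h : 5 ∣ |x| + |y| ∨ 5 ∣ |x| - |y|) :
    5 ∣ x ↔ 5 ∣ y := by
  rcases abs_cases x with h1 | h1 <;> rcases abs_cases y with h2 | h2 <;> omega

theorem dvd_val_neg_iff {p : ℤ} (hp : p ∣ n) (s : ZMod n) :
    p ∣ ((-s).val : ℤ) ↔ p ∣ (s.val : ℤ) := by
  have h : (n : ℤ) ∣ (-s).val + s.val := by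
    rw [← ZMod.intCast_zmod_eq_zero_iff_dvd]
    simp
  rw [← dvd_neg (b := (s.val : ℤ))]
  exact dvd_iff_dvd_of_dvd_sub (by simpa using hp.trans h)

/-- Type 2 makes `n / 3`, a multiple of `5`, a sum or difference of reduced representatives. So `5`
divides all three connection elements or none. -/
theorem not_isAdmissibleType2_of_not_five_dvd {S : Finset (ZMod n)} {a c : ZMod n} {j : ℕ}
    (ha : a ∈ S) (hc : c ∈ S) (ha5 : ¬ 5 ∣ (a.val : ℤ)) (hc5 : 5 ∣ (c.val : ℤ)) (h15 : 15 ∣ n)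
    (hj : ¬ (5 : ℤ) ∣ j) : ¬ IsAdmissibleType2 n S j := by
  rintro ⟨-, r₁, r₂, r₃, ⟨-, -, s₁, s₂, s₃, hS, h1, h2, h3⟩, -, -, hr2, hr3⟩
  rw [reducedAngle_eq_iff] at h1 h2 h3
  have h12 : 3 * (|minRep n j s₁| + |minRep n j s₂|) = n := by
    rw [hr2] at h2; qify; push_cast at h1 h2; linarith
  have h13 : 3 * (|minRep n j s₃| - |minRep n j s₁|) = n := by
    rw [hr3] at h3; qify; push_cast at h1 h3; linarith
  have e12 : 5 ∣ minRep n j s₁ ↔ 5 ∣ minRep n j s₂ := five_dvd_iff_of_dvd_abs (Or.inl (by omega))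
  have e13 : 5 ∣ minRep n j s₃ ↔ 5 ∣ minRep n j s₁ := five_dvd_iff_of_dvd_abs (Or.inr (by omega))
  have h5n : (5 : ℤ) ∣ n := by omega
  have hval : ∀ s : ZMod n, 5 ∣ minRep n j s ↔ (5 : ℤ) ∣ s.val := fun s => by
    rw [← dvd_iff_dvd_of_dvd_sub (h5n.trans (dvd_minRep_sub j s))]
    exact ⟨fun h => (Int.prime_five.dvd_or_dvd h).resolve_left hj, fun h => h.mul_left _⟩
  have hneg := dvd_val_neg_iff (n := n) h5n
  rw [hval, hval] at e12 e13
  rw [hS] at ha hc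
  simp only [mem_insert, mem_singleton] at ha hc
  refine ha5 ?_
  have hall : (5 : ℤ) ∣ s₁.val := by
    rcases hc with rfl | rfl | rfl | rfl | rfl | rfl <;> (try simp only [hneg] at hc5) <;> tauto
  rcases ha with rfl | rfl | rfl | rfl | rfl | rfl <;> (try simp only [hneg]) <;> tauto

/-- The middle angle `1/2` means that `j * s₂` has order four, and `4 ∤ 30`. -/
theorem not_dvd_thirty_mul_of_type1 {S : Finset (ZMod n)} {j : ℕ} (h : IsAdmissibleType1 n S j) :
    ¬ (n : ℤ) ∣ 30 * j := by
  intro h30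
  obtain ⟨-, r₁, r₂, r₃, ⟨-, -, s₁, s₂, s₃, -, -, h2, -⟩, -, -, hr2, -⟩ := h
  rw [reducedAngle_eq_iff, hr2] at h2
  have h4 : 4 * |minRep n j s₂| = n := by
    qify; push_cast at h2; linarith
  have hd : (n : ℤ) ∣ 30 * minRep n j s₂ := by
    rw [dvd_mul_minRep_iff, ← mul_assoc]; exact h30.mul_right _
  rw [← dvd_abs, abs_mul, ← h4] at hd
  have h0 : |minRep n j s₂| ≠ 0 := by
    intro h0
    rw [h0] at h4
    exact NeZero.ne n (by exact_mod_cast h4.symm)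
  have := (mul_dvd_mul_iff_right h0).1 hd
  norm_num at this

end

/-! ### Arithmetic of `n` and of the element divisible by five -/

theorem dvd_twelve_mul {n m : ℕ} (h : n ∣ 60 * m) (hm : 5 ∣ m) (hn : 5 ∣ n) (h25 : ¬ 25 ∣ n) :
    n ∣ 12 * m := by
  obtain ⟨q, rfl⟩ := hn
  have hq5 : Nat.Coprime 5 q := (Nat.Prime.coprime_iff_not_dvd Nat.prime_five).2 (by omega)
  rw [show 60 * m = 5 * (12 * m) by ring, Nat.mul_dvd_mul_iff_left (by norm_num)] at h
  exact hq5.mul_dvd_of_dvd_of_dvd (hm.mul_left 12) h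

theorem four_dvd_of_dvd_four_mul {n x : ℤ} (h4 : n ∣ 4 * x) (h2 : ¬ n ∣ 2 * x) : 4 ∣ n := by
  obtain ⟨k, hk⟩ := h4
  rcases Int.even_or_odd' k with ⟨l, rfl | rfl⟩
  · exact absurd ⟨l, by linarith⟩ h2
  · have h2n : 2 ∣ n := by
      have : n = 2 * (2 * x - n * l) := by linarith
      exact ⟨_, this⟩
    obtain ⟨m, rfl⟩ := h2n
    have : 2 * m = 4 * (x - m * l) := by linarith
    exact ⟨_, this⟩

theorem ordProj_eq_self {p n : ℕ} (hp : p.Prime) (h : p ∣ n) (h2 : ¬ p ^ 2 ∣ n) :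
    ordProj[p] n = p := by
  have hn : n ≠ 0 := by
    rintro rfl
    exact h2 (dvd_zero _)
  have h1 := (hp.pow_dvd_iff_le_factorization hn (k := 1)).1 (by rwa [pow_one])
  rw [hp.pow_dvd_iff_le_factorization hn] at h2
  rw [show n.factorization p = 1 by omega, pow_one]

section

variable {n : ℕ} [NeZero n]

/-- The unique connection element divisible by five, once its order is known to be twelve. -/
theorem exists_unique_five_dvd {S : Finset (ZMod n)} {a b c : ZMod n}
    (hS : S = {a, -a, b, -b, c, -c}) (hT : IsExceptionalTriple a.val b.val c.val) (h5n : 5 ∣ n)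
    {h : ℕ} (hn : n = 12 * h) {k : ℕ} (hk : c.val = h * k) (h2 : ¬ 2 ∣ k) (h3 : ¬ 3 ∣ k) :
    (∃! s : ZMod n, s ∈ S ∧ 5 ∣ s.val ∧ (s.val : ℚ) < n / 2) ∧
      ∀ s : ZMod n, s ∈ S → 5 ∣ s.val → (s.val : ℚ) < n / 2 →
        ((s.val : ℚ) = n / 12 ∨ (s.val : ℚ) = 5 * n / 12) := by
  have hneg := dvd_val_neg_iff (n := n) (p := 5) (by exact_mod_cast h5n)
  have hh : 0 < h := by
    have := NeZero.ne n
    omega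
  have hc5 := hT.five_right
  have hmem : ∀ s ∈ S, 5 ∣ s.val → s = c ∨ s = -c := by
    intro s hs h5
    have h5' : (5 : ℤ) ∣ s.val := by exact_mod_cast h5
    rw [hS] at hs
    simp only [mem_insert, mem_singleton] at hs
    rcases hs with rfl | rfl | rfl | rfl | h | h
    · exact absurd h5' hT.five_left
    · exact absurd ((hneg _).1 h5') hT.five_left
    · exact absurd h5' hT.five_mid
    · exact absurd ((hneg _).1 h5') hT.five_mid
    · exact Or.inl h
    · exact Or.inr h
  have hk12 : k < 12 := by
    have := ZMod.val_lt c
    rw [hk] at this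
    exact lt_of_mul_lt_mul_left (this.trans_eq (hn.trans (mul_comm _ _))) hh.le
  have hc0 : c ≠ 0 := by
    rintro rfl
    exact hT.three_right (by simp)
  have hcneg : (-c).val = h * (12 - k) := by
    rw [ZMod.neg_val, if_neg hc0, hk, Nat.mul_sub]
    omega
  have hcS : c ∈ S := by rw [hS]; simp
  have hcS' : -c ∈ S := by rw [hS]; simp
  have hd : 5 ∣ c.val := by exact_mod_cast hc5
  have hd' : 5 ∣ (-c).val := by exact_mod_cast (hneg c).2 hc5
  have hnq : (n : ℚ) = 12 * h := by rw [hn]; push_cast; rfl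
  have hhq : (0 : ℚ) < h := by exact_mod_cast hh
  -- Here `t` is the one of `±c` below `n / 2`. Its multiplier of `h = n / 12` is prime to `6` and
  -- less than `6`, hence `1` or `5`.
  have key : ∀ t t' : ZMod n, (t = c ∧ t' = -c ∨ t = -c ∧ t' = c) →
      ∀ l l' : ℕ, t.val = h * l → t'.val = h * l' → 6 < l' → (l = 1 ∨ l = 5) →
      (∃! s : ZMod n, s ∈ S ∧ 5 ∣ s.val ∧ (s.val : ℚ) < n / 2) ∧
      ∀ s : ZMod n, s ∈ S → 5 ∣ s.val → (s.val : ℚ) < n / 2 →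
        ((s.val : ℚ) = n / 12 ∨ (s.val : ℚ) = 5 * n / 12) := by
    intro t t' htt l l' hl hl' h6 hl15
    have htS : t ∈ S ∧ 5 ∣ t.val := by
      rcases htt with ⟨rfl, -⟩ | ⟨rfl, -⟩
      exacts [⟨hcS, hd⟩, ⟨hcS', hd'⟩]
    have huniq : ∀ s ∈ S, 5 ∣ s.val → (s.val : ℚ) < n / 2 → s = t := by
      intro s hs h5 hlt
      have hst : s = t ∨ s = t' := by
        rcases htt with ⟨rfl, rfl⟩ | ⟨rfl, rfl⟩
        exacts [hmem s hs h5, (hmem s hs h5).symm]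
      refine hst.resolve_right ?_
      rintro rfl
      rw [hl', hnq] at hlt
      push_cast at hlt
      have : (6 : ℚ) < l' := by exact_mod_cast h6
      nlinarith
    refine ⟨⟨t, ⟨htS.1, htS.2, ?_⟩, fun s hs => huniq s hs.1 hs.2.1 hs.2.2⟩,
      fun s hs h5 hlt => ?_⟩
    · rw [hl, hnq]
      rcases hl15 with rfl | rfl <;> push_cast <;> linarith
    · rw [huniq s hs h5 hlt, hl, hnq]
      rcases hl15 with rfl | rfl
      · left; push_cast; ring
      · right; push_cast; ring
  by_cases hk6 : k < 6
  · exact key c (-c) (Or.inl ⟨rfl, rfl⟩) k (12 - k) hk hcneg (by omega) (by omega)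
  · exact key (-c) c (Or.inr ⟨rfl, rfl⟩) (12 - k) k hcneg hk (by omega) (by omega)

end

/-! ### Proof of the proposition -/

theorem mainTheorem4 (n : ℕ) [NeZero n] (hn : 7 ≤ n) (a b c : ZMod n) (S : Finset (ZMod n))
    (hS : S = {a, -a, b, -b, c, -c}) (hcard : S.card = 6)
    (hgen : AddSubgroup.closure (S : Set (ZMod n)) = ⊤)
    (hmagic : IsDistanceMagic (SimpleGraph.circulantGraph (S : Set (ZMod n))))
    (htype3 : ∃ j : ℕ, IsAdmissibleType3 n S j) :
    (60 ∣ n ∧ ordProj[3] n = 3 ∧ ordProj[5] n = 5) ∧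
    ((∃! s : ZMod n, s ∈ S ∧ 5 ∣ s.val ∧ (s.val : ℚ) < n / 2) ∧
      ∀ s : ZMod n, s ∈ S → 5 ∣ s.val → (s.val : ℚ) < n / 2 →
        ((s.val : ℚ) = n / 12 ∨ (s.val : ℚ) = 5 * n / 12)) ∧
    ((∃ j : ℕ, IsAdmissibleType1 n S j) ∧ ¬ ∃ j : ℕ, IsAdmissibleType2 n S j) ∧
    ((∀ j : ℕ, IsAdmissibleType1 n S j → Odd j ∧ 15 ∣ j) ∧
      ∀ j : ℕ, IsAdmissibleType3 n S j → Even j ∧ Nat.Coprime j 15) := by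
  have h0 : (0 : ZMod n) ∉ S := by
    obtain ⟨h1, -, h3, -, h5⟩ := pairwise_ne_of_card_eq_six hS hcard
    rw [hS]
    intro h
    simp only [mem_insert, mem_singleton, not_or] at h h1 h3 h5
    rcases h with h | h | h | h | h | h
    · exact h1.1 (by rw [← h, neg_zero])
    · exact h1.1 (by rw [← h, neg_eq_zero.1 h.symm])
    · exact h3.1 (by rw [← h, neg_zero])
    · exact h3.1 (by rw [← h, neg_eq_zero.1 h.symm])
    · exact h5 (by rw [← h, neg_zero])
    · exact h5 (by rw [← h, neg_eq_zero.1 h.symm])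
  have hneg : ∀ s ∈ S, -s ∈ S := by
    intro s hs
    rw [hS] at hs ⊢
    simp only [mem_insert, mem_singleton] at hs ⊢
    rcases hs with rfl | rfl | rfl | rfl | rfl | rfl <;> simp
  obtain ⟨hann, hthree⟩ := hmagic.admissible h0 hneg
  obtain ⟨j₀, hj₀⟩ := htype3
  obtain ⟨h30, a, b, c, hS, hT⟩ := hj₀.exists_exceptional hgen
  have hsum : ∀ j ∈ admissibleSet n S, CosSumEqZero n (j * a.val) (j * b.val) (j * c.val) :=
    fun j hj => cosSumEqZero_of_mem_admissibleSet hS hcard hj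
  -- Otherwise `n / p` would be a nonzero common annihilator.
  have hkill : ∀ (p : ℕ), 1 < p → p ∣ n → ¬ ∀ j ∈ admissibleSet n S, (p : ℤ) ∣ j := by
    rintro p hp ⟨t, ht⟩ hall
    have ht0 : 0 < t := Nat.pos_of_ne_zero (ne_zero_of_eq_mul ht)
    have := hann (t : ZMod n) fun j hj => by
      rw [← Nat.cast_mul, ZMod.natCast_eq_zero_iff]
      nth_rewrite 1 [ht]
      exact mul_dvd_mul_right (by exact_mod_cast hall j hj) t
    rw [ZMod.natCast_eq_zero_iff] at this
    have := Nat.le_of_dvd ht0 this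
    nlinarith
  have h9 : ¬ 9 ∣ n := fun h9 => hkill 3 (by norm_num) (by omega) fun j hj => by
    exact_mod_cast three_dvd_of_nine_dvd hT (hsum j hj) h9
  have h25 : ¬ 25 ∣ n := fun h25 => hkill 5 (by norm_num) (by omega) fun j hj => by
    exact_mod_cast five_dvd_of_twentyfive_dvd hT (hsum j hj) h25
  have hdich := fun j (hj : j ∈ admissibleSet n S) =>
    admissible_dichotomy hS hcard hgen hT h30 h9 h25 hj
  obtain ⟨j₁, hj₁, hj₁3⟩ : ∃ j ∈ admissibleSet n S, (3 : ℤ) ∣ j := by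
    obtain ⟨t, ht⟩ : 3 ∣ n := by omega
    obtain ⟨j, hj, hjt⟩ := hthree (by rw [even_iff_two_dvd]; omega) (t : ZMod n) (by
      rw [← Nat.cast_ofNat, ← Nat.cast_mul, ← ht, ZMod.natCast_self])
    refine ⟨j, hj, ?_⟩
    rw [← Nat.cast_mul, ZMod.natCast_eq_zero_iff] at hjt
    nth_rewrite 1 [ht] at hjt
    exact_mod_cast (Nat.mul_dvd_mul_iff_right (Nat.pos_of_ne_zero (ne_zero_of_eq_mul ht))).1 hjt
  obtain ⟨h15₁, ⟨hc4, hc2⟩, hab⟩ := (hdich j₁ hj₁).resolve_left fun h => h.2.2 hj₁3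
  have htype1 := isAdmissibleType1_of_dvd hS hj₁ hc4 hc2 hab
  -- The first kind gives `n ∣ 30 * j`, the second `n ∣ 4 * j * c`; `60` is a common multiple of
  -- `30` and `4`.
  have h60c : (n : ℤ) ∣ 60 * c.val := by
    rw [natCast_dvd_mul_val_iff]
    refine hann _ fun j hj => ?_
    rw [mul_left_comm, ← Int.cast_natCast j, ← mul_assoc, ← Int.cast_mul,
      ← natCast_dvd_mul_val_iff]
    rcases hdich j hj with ⟨h, -⟩ | ⟨-, ⟨h, -⟩, -⟩
    · exact (h.mul_right (2 * c.val)).trans (dvd_of_eq (by ring))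
    · exact (h.mul_right 15).trans (dvd_of_eq (by ring))
  obtain ⟨e, he⟩ : n ∣ 12 * c.val := dvd_twelve_mul (by exact_mod_cast h60c)
    (by exact_mod_cast hT.five_right) (by omega) h25
  have h4n : 4 ∣ n := by exact_mod_cast four_dvd_of_dvd_four_mul hc4 hc2
  obtain ⟨h, hh⟩ : 12 ∣ n := by omega
  have hk : c.val = h * e :=
    Nat.eq_of_mul_eq_mul_left (by norm_num : 0 < 12) (he.trans (by rw [hh, mul_assoc]))
  -- For even `e`, the factors `15 ∣ j₁` and `2` would make `2 * j₁ * c` a multiple of `60 * h = 5 *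
  -- n`.
  have hk2 : ¬ 2 ∣ e := by
    rintro ⟨l, rfl⟩
    refine hc2 ?_
    obtain ⟨m, hm⟩ := h15₁
    rw [hm, hk, hh]
    exact ⟨5 * m * l, by push_cast; ring⟩
  have hk3 : ¬ 3 ∣ e := fun h3 => hT.three_right (by rw [hk]; push_cast; exact_mod_cast h3.mul_left h)
  refine ⟨⟨by omega, ?_, ?_⟩, exists_unique_five_dvd hS hT (by omega) hh hk hk2 hk3,
    ⟨⟨j₁, htype1⟩, ?_⟩, fun j hj => ?_, fun j hj => ?_⟩
  · exact ordProj_eq_self Nat.prime_three (by omega) (by omega)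
  · exact ordProj_eq_self Nat.prime_five (by omega) (by omega)
  · rintro ⟨j, hj⟩
    rcases hdich j hj.1 with ⟨-, h5, -⟩ | ⟨h15, -⟩
    · exact not_isAdmissibleType2_of_not_five_dvd (a := a) (c := c) (by simp [hS]) (by simp [hS])
        hT.five_left hT.five_right (by omega) h5 hj
    · exact not_isAdmissibleType2_of_fifteen_dvd (by omega) h9 h15 hj
  · obtain ⟨h15, ⟨-, hc2'⟩, -⟩ :=
      (hdich j hj.1).resolve_left fun h => not_dvd_thirty_mul_of_type1 hj h.1
    refine ⟨?_, by exact_mod_cast h15⟩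
    rw [← Nat.not_even_iff_odd, even_iff_two_dvd]
    intro h2
    obtain ⟨m, hm⟩ : (30 : ℤ) ∣ j := by omega
    exact hc2' ((h60c.mul_right m).trans (dvd_of_eq (by rw [hm]; ring)))
  · have h30j := hj.dvd_thirty_mul hgen
    have h5j : ¬ (5 : ℤ) ∣ j ∧ ¬ (3 : ℤ) ∣ j := by
      rcases hdich j hj.1 with ⟨-, h⟩ | ⟨-, ⟨h4, h2⟩, -⟩
      · exact h
      · refine absurd ?_ h2
        -- This uses `2 = 30 - 7 * 4`.
        exact (dvd_sub (h30j.mul_right c.val) (h4.mul_right 7)).trans (dvd_of_eq (by ring))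
    constructor
    · rw [even_iff_two_dvd]
      have : (4 : ℤ) ∣ 30 * j := (by exact_mod_cast h4n : (4 : ℤ) ∣ n).trans h30j
      omega
    · rw [show (15 : ℕ) = 3 * 5 by rfl]
      refine Nat.Coprime.mul_right ?_ ?_
      · exact ((Nat.Prime.coprime_iff_not_dvd Nat.prime_three).2 (by omega)).symm
      · exact ((Nat.Prime.coprime_iff_not_dvd Nat.prime_five).2 (by omega)).symm
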